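/- Let $\Sigma$ be a surface (a Hausdorff $C^\infty$ manifold of dimension $2$) with a $C^\infty$ torsion-free connection $\nabla$ in $T\Sigma$. Use the conventions $R(u,v)a=\nabla_v\nabla_u a-\nabla_u\nabla_v a+\nabla_{[u,v]}a$ for the curvature, $\rho(u,a)=\operatorname{tr}\,[v\mapsto R(u,v)a]$ for the Ricci tensor, $\beta\wedge\xi=\beta\otimes\xi-\xi\otimes\beta$ and $[d\xi](u,v)=d_u[\xi(v)]-d_v[\xi(u)]-\xi([u,v])$ for $1$-forms. Suppose that $\rho$ is skew-symmetric and nonzero at every point, and let the $1$-form $\phi$ and the vector field $w$ be determined by $\nabla\rho=\phi\otimes\rho$ and $\phi=\rho(w,\cdot)$. Suppose further that $\nabla$ is generic, that is, the bundle morphism $Q:T\Sigma\to T\Sigma$ given by $Qv=4v+\nabla_v w+\tfrac34\phi(v)w$ is an isomorphism; its dual $Q^*:T^*\Sigma\to T^*\Sigma$ sends $\xi$ to the composite $\xi Q$. Let $S_1$ and $S_2$ be the real vector spaces of all $C^\infty$ $1$-forms and of all $C^\infty$ symmetric $2$-tensors (twice-covariant tensor fields) on $\Sigma$. For $\xi\in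 S_1$ and $\tau\in S_2$ define the Killing operator $\mathcal L$ and operators $\mathcal B,\mathcal D,\mathcal Z,\mathcal P$ by $$2[\mathcal L\xi](u,v)=[\nabla_u\xi](v)+[\nabla_v\xi](u),\qquad [(\mathcal B\tau)(v)]\,\rho(u,u')=[\nabla_u\tau](u',v)-[\nabla_{u'}\tau](u,v),\qquad 2[\mathcal D\xi]\,\rho=\xi\wedge\phi-d\xi,$$ $$\mathcal Z\tau=2\,d[\mathcal D(\mathcal B\tau)]+4\,\mathcal B\tau-\tau(w,\cdot)+\tfrac32[\mathcal D(\mathcal B\tau)]\,\phi,\qquad \mathcal P\tau=\tau-\mathcal L[(Q^*)^{-1}\mathcal Z\tau].$$ Then $\mathcal L$ and $\mathcal P$ are well-defined linear operators $\mathcal L:S_1\to S_2$ and $\mathcal P:S_2\to S_2$, and: (a) $\mathcal L(S_1)=\operatorname{Ker}\mathcal P$. (b) $S_2=\mathcal L(S_1)\oplus\operatorname{Ker}(\mathcal P-\mathrm{Id})$, and $\mathcal P$ is the projection onto the second summand for this decomposition. (c) The image of $\mathcal P:S_2\to S_2$ coincides both with $\operatorname{Ker}(\mathcal P-\mathrm{Id})$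 and with the space of all $\tau\in S_2$ such that $\mathcal Z\tau=0$. -/

import Mathlib

open scoped Manifold ContDiff Bundle

noncomputable section

namespace RSTS

/-- The model plane for surfaces. -/
abbrev Plane : Type := EuclideanSpace ℝ (Fin 2)

section LinearAlgebra

variable {V W U : Type*}
  [AddCommGroup V] [Module ℝ V] [TopologicalSpace V]
  [AddCommGroup W] [Module ℝ W] [TopologicalSpace W]
  [AddCommGroup U] [Module ℝ U] [TopologicalSpace U]

open Classical in
/-- Regard a map which is known to be (continuous and) linear as an element of `V →L[ℝ] W`
(the value is `0` for a map which is not linear). -/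
def toCLM (f : V → W) : V →L[ℝ] W :=
  if h : ∃ A : V →L[ℝ] W, ⇑A = f then h.choose else 0

/-- `toCLM` does not change the underlying map of a continuous linear map. -/
theorem toCLM_coe (A : V →L[ℝ] W) : toCLM (⇑A) = A := by
  have h : ∃ B : V →L[ℝ] W, ⇑B = ⇑A := ⟨A, rfl⟩
  unfold toCLM
  rw [dif_pos h]
  exact DFunLike.coe_injective h.choose_spec

/-- Regard a map `f : V → W → ℝ` which is known to be (continuous and) bilinear as an element of
`V →L[ℝ] W →L[ℝ] ℝ`. -/
def toCLM₂ [IsTopologicalAddGroup W] (f : V → W → ℝ) : V →L[ℝ] W →L[ℝ] ℝ :=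
  toCLM fun v => toCLM (f v)

/-- `toCLM₂` does not change the underlying map of a continuous bilinear map. -/
theorem toCLM₂_coe [IsTopologicalAddGroup W] (A : V →L[ℝ] W →L[ℝ] ℝ) :
    toCLM₂ (fun v w => A v w) = A := by
  have h : (fun v => toCLM fun w => A v w) = ⇑A := funext fun v => toCLM_coe (A v)
  unfold toCLM₂
  rw [h, toCLM_coe]

end LinearAlgebra

variable {M : Type*} [TopologicalSpace M] [ChartedSpace Plane M]

section Fields

variable (M)

/-- Vector fields on `M`, without any regularity requirement. -/
abbrev VField : Type _ := (x : M) → TangentSpace (𝓡 2) x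

/-- `1`-forms on `M`, without any regularity requirement. -/
abbrev Form : Type _ := (x : M) → TangentSpace (𝓡 2) x →L[ℝ] ℝ

/-- Twice-covariant tensor fields on `M`, without any regularity requirement. -/
abbrev Tensor₂ : Type _ :=
  (x : M) → TangentSpace (𝓡 2) x →L[ℝ] TangentSpace (𝓡 2) x →L[ℝ] ℝ

/-- A (not necessarily smooth) connection in the tangent bundle of `M`. The covariant derivative
`∇_u v` at `x` is `cov v x (u x)`. -/
abbrev Connection [IsManifold (𝓡 2) ∞ M] : Type _ :=
  CovariantDerivative (𝓡 2) Plane (fun x : M => TangentSpace (𝓡 2) x)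

/-! Shortcuts for type class search. -/

instance instContinuousAddCotangent (x : M) :
    ContinuousAdd (TangentSpace (𝓡 2) x →L[ℝ] ℝ) := inferInstance

instance instModuleTensorAt (x : M) :
    Module ℝ (TangentSpace (𝓡 2) x →L[ℝ] TangentSpace (𝓡 2) x →L[ℝ] ℝ) := inferInstance

instance instAddCommGroupTensor : AddCommGroup (Tensor₂ M) := inferInstance

instance instModuleTensor : Module ℝ (Tensor₂ M) := inferInstance

variable {M} in
/-- The space of `C^∞` sections of a vector bundle `V` over `M`. -/
def smoothSections (F : Type*) [NormedAddCommGroup F] [NormedSpace ℝ F]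
    (V : M → Type*) [TopologicalSpace (Bundle.TotalSpace F V)]
    [∀ x, TopologicalSpace (V x)] [∀ x, AddCommGroup (V x)] [∀ x, Module ℝ (V x)]
    [FiberBundle F V] [VectorBundle ℝ F V] : Submodule ℝ ((x : M) → V x) where
  carrier := {s | ContMDiff (𝓡 2) ((𝓡 2).prod 𝓘(ℝ, F)) ∞
    fun x => Bundle.TotalSpace.mk' F x (s x)}
  add_mem' hσ hτ := ContMDiff.add_section hσ hτ
  zero_mem' := Bundle.contMDiff_zeroSection ℝ V
  smul_mem' _ _ hτ := ContMDiff.const_smul_section hτ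

/-- The space of all symmetric twice-covariant tensor fields on `M`. -/
def symmetricTensors : Submodule ℝ (Tensor₂ M) where
  carrier := {τ | ∀ (x : M) (u v : TangentSpace (𝓡 2) x), τ x u v = τ x v u}
  add_mem' hσ hτ x u v := congrArg₂ (· + ·) (hσ x u v) (hτ x u v)
  zero_mem' _ _ _ := rfl
  smul_mem' c _ hτ x u v := congrArg (c * ·) (hτ x u v)

/-- The space of `C^∞` `1`-forms on `M`. -/
def S₁ [IsManifold (𝓡 2) ∞ M] : Submodule ℝ (Form M) :=
  smoothSections (Plane →L[ℝ] ℝ) fun x : M => TangentSpace (𝓡 2) x →L[ℝ] ℝ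

set_option synthInstance.maxHeartbeats 200000 in
/-- The space of `C^∞` symmetric twice-covariant tensor fields on `M`. -/
def S₂ [IsManifold (𝓡 2) ∞ M] : Submodule ℝ (Tensor₂ M) :=
  smoothSections (Plane →L[ℝ] Plane →L[ℝ] ℝ)
    (fun x : M => TangentSpace (𝓡 2) x →L[ℝ] TangentSpace (𝓡 2) x →L[ℝ] ℝ) ⊓ symmetricTensors M

end Fields

/-- A vector field defined (and smooth near `x`) with prescribed value `v` at `x`. All the tensors
below are independent of the choice of such extensions. -/
abbrev ext {x : M} [IsManifold (𝓡 2) ∞ M] (v : TangentSpace (𝓡 2) x) : VField M :=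
  FiberBundle.extend Plane v

/-- The quotient `α / β` of two skew-symmetric bilinear forms on the tangent plane at `x`, that is,
the number `c` with `α = c β` (when `β ≠ 0`), evaluated on a basis of the plane. -/
def skewQuotient {x : M} (α β : TangentSpace (𝓡 2) x → TangentSpace (𝓡 2) x → ℝ) : ℝ :=
  let e₁ : TangentSpace (𝓡 2) x := (EuclideanSpace.single 0 1 : Plane)
  let e₂ : TangentSpace (𝓡 2) x := (EuclideanSpace.single 1 1 : Plane)
  α e₁ e₂ / β e₁ e₂

variable [IsManifold (𝓡 2) ∞ M]

/-- The exterior derivative of a `1`-form: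
`[dξ](u,v) = d_u[ξ(v)] - d_v[ξ(u)] - ξ([u,v])`. -/
def extDer (ξ : Form M) (x : M) (u v : TangentSpace (𝓡 2) x) : ℝ :=
  mvfderiv (𝓡 2) (fun y => ξ y (ext v y)) x u - mvfderiv (𝓡 2) (fun y => ξ y (ext u y)) x v
    - ξ x (VectorField.mlieBracket (𝓡 2) (ext u) (ext v) x)

/-- The exterior product `β ∧ ξ = β ⊗ ξ - ξ ⊗ β` of two `1`-forms. -/
def wedge (β ξ : Form M) (x : M) (u v : TangentSpace (𝓡 2) x) : ℝ :=
  β x u * ξ x v - ξ x u * β x v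

variable (cov : Connection M)

/-- The covariant derivative of a `1`-form:
`[∇_u ξ](v) = d_u[ξ(v)] - ξ(∇_u v)`. -/
def nablaForm (ξ : Form M) (x : M) (u v : TangentSpace (𝓡 2) x) : ℝ :=
  mvfderiv (𝓡 2) (fun y => ξ y (ext v y)) x u - ξ x (cov (ext v) x u)

/-- The covariant derivative of a twice-covariant tensor field:
`[∇_u τ](v,v') = d_u[τ(v,v')] - τ(∇_u v, v') - τ(v, ∇_u v')`. -/
def nablaTensor (τ : Tensor₂ M) (x : M) (u v v' : TangentSpace (𝓡 2) x) : ℝ :=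
  mvfderiv (𝓡 2) (fun y => τ y (ext v y) (ext v' y)) x u
    - τ x (cov (ext v) x u) v' - τ x v (cov (ext v') x u)

/-- The curvature tensor, with the sign convention
`R(u,v)a = ∇_v ∇_u a - ∇_u ∇_v a + ∇_{[u,v]} a`. -/
def curvature (x : M) (u v a : TangentSpace (𝓡 2) x) : TangentSpace (𝓡 2) x :=
  cov (fun y => cov (ext a) y (ext u y)) x v - cov (fun y => cov (ext a) y (ext v y)) x u
    + cov (ext a) x (VectorField.mlieBracket (𝓡 2) (ext u) (ext v) x)

/-- The Ricci tensor: `ρ(u,a)` is the trace of `v ↦ R(u,v)a`. -/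
def ricci : Tensor₂ M := fun x =>
  toCLM₂ fun u a =>
    LinearMap.trace ℝ (TangentSpace (𝓡 2) x) (toCLM fun v => curvature cov x u v a).toLinearMap

/-- The Killing operator: `2[Lξ](u,v) = [∇_u ξ](v) + [∇_v ξ](u)`. -/
def killing (ξ : Form M) : Tensor₂ M := fun x =>
  toCLM₂ fun u v => (nablaForm cov ξ x u v + nablaForm cov ξ x v u) / 2

/-- The Codazzi operator: `[d^∇ τ](u,v,·) = [∇_u τ](v,·) - [∇_v τ](u,·)`. -/
def codazzi (τ : Tensor₂ M) (x : M) (u v a : TangentSpace (𝓡 2) x) : ℝ :=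
  nablaTensor cov τ x u v a - nablaTensor cov τ x v u a

/-- The recurrence `1`-form `φ`, characterized by `∇ρ = φ ⊗ ρ`. -/
def recurrenceForm : Form M := fun x =>
  toCLM fun u => skewQuotient (nablaTensor cov (ricci cov) x u) (fun v v' => ricci cov x v v')

/-- The vector field `w` characterized by `φ = ρ(w, ·)`. -/
def recurrenceField : VField M := fun x =>
  (ricci cov x).inverse (recurrenceForm cov x)

/-- The bundle morphism `Q = 4 + ∇w + 3 φ ⊗ w / 4` from the tangent bundle to itself, where `∇w`
sends `v` to `∇_v w` and `φ ⊗ w` sends `v` to `φ(v) w`. -/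
def morphismQ (x : M) : TangentSpace (𝓡 2) x →L[ℝ] TangentSpace (𝓡 2) x :=
  (4 : ℝ) • ContinuousLinearMap.id ℝ (TangentSpace (𝓡 2) x) + cov (recurrenceField cov) x
    + (3 / 4 : ℝ) • (recurrenceForm cov x).smulRight (recurrenceField cov x)

/-- The dual `Q^*` of the morphism `Q`, sending `ξ` to the composite `ξ Q`. -/
def dualQ (x : M) : (TangentSpace (𝓡 2) x →L[ℝ] ℝ) →L[ℝ] (TangentSpace (𝓡 2) x →L[ℝ] ℝ) :=
  ContinuousLinearMap.precomp ℝ (morphismQ cov x)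

/-- The operator `B`, sending symmetric `2`-tensors to `1`-forms:
`[(Bτ)(v)] ρ = [d^∇ τ](·,·,v)`. -/
def opB (τ : Tensor₂ M) : Form M := fun x =>
  toCLM fun v => skewQuotient (fun u u' => codazzi cov τ x u u' v) (fun u u' => ricci cov x u u')

/-- The operator `D`, sending `1`-forms to functions: `2[Dξ] ρ = ξ ∧ φ - dξ`. -/
def opD (ξ : Form M) (x : M) : ℝ :=
  skewQuotient (fun u v => wedge ξ (recurrenceForm cov) x u v - extDer ξ x u v)
    (fun u v => ricci cov x u v) / 2

/-- The third-order operator `Z`, sending symmetric `2`-tensors to `1`-forms: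
`Zτ = 2 d[D(Bτ)] + 4 Bτ - τ(w,·) + 3 [D(Bτ)] φ / 2`. -/
def opZ (τ : Tensor₂ M) : Form M := fun x =>
  (2 : ℝ) • mvfderiv (𝓡 2) (opD cov (opB cov τ)) x + (4 : ℝ) • opB cov τ x
    - τ x (recurrenceField cov x) + (3 / 2 * opD cov (opB cov τ) x) • recurrenceForm cov x

/-- The fourth-order operator `P`, sending symmetric `2`-tensors to symmetric `2`-tensors:
`Pτ = τ - L[(Q^*)⁻¹ Zτ]`. -/
def opP (τ : Tensor₂ M) : Tensor₂ M := fun x =>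
  τ x - killing cov (fun y => (dualQ cov y).inverse (opZ cov τ y)) x

/-- A generic RSTS connection: a `C^∞` torsion-free connection on a surface whose Ricci tensor is
skew-symmetric and nonzero at every point, and for which `Q` is an isomorphism. -/
structure IsGenericRSTS : Prop where
  smooth : CovariantDerivative.ContMDiffCovariantDerivative cov ∞
  torsionFree : cov.torsion = 0
  ricci_skew : ∀ (x : M) (u v : TangentSpace (𝓡 2) x), ricci cov x u v = - ricci cov x v u
  ricci_ne_zero : ∀ x : M, ricci cov x ≠ 0
  isomorphism : ∀ x : M, (morphismQ cov x).IsInvertible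

end RSTS

end

set_option linter.unusedSectionVars false

noncomputable section
namespace RSTS

open Bundle Topology

/-- The components of a connection in a commuting frame: the coefficients lie in a commutative
algebra `A` with derivations `d i`, `Γ i j k` is the `k`-th component of `∇_{e_i} e_j`, `r` is the
value of the Ricci form on the frame, `s` is meant to be `r⁻¹` and `c` to be `1 / 2`. -/
structure FrameData (A : Type*) [CommRing A] [Algebra ℝ A] where
  d : Fin 2 → Derivation ℝ A A
  Γ : Fin 2 → Fin 2 → Fin 2 → A
  r : A
  s : A
  c : A

namespace FrameData

variable {A : Type*} [CommRing A] [Algebra ℝ A] (S : FrameData A)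

/-- The `k`-th component of `R(e_0, e_1) e_a`. -/
def curv (a k : Fin 2) : A :=
  S.d 1 (S.Γ 0 a k) - S.d 0 (S.Γ 1 a k)
    + ∑ l, (S.Γ 0 a l * S.Γ 1 l k - S.Γ 1 a l * S.Γ 0 l k)

/-- The components of the recurrence form. -/
def phi (i : Fin 2) : A := S.s * S.d i S.r - (S.Γ i 0 0 + S.Γ i 1 1)

/-- The components of the recurrence field. -/
def w : Fin 2 → A := ![S.s * S.phi 1, - (S.s * S.phi 0)]

/-- The components of `∇ξ`. -/
def covForm (ξ : Fin 2 → A) (i j : Fin 2) : A := S.d i (ξ j) - ∑ k, S.Γ i j k * ξ k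

/-- The components of `∇τ`. -/
def covTensor (τ : Fin 2 → Fin 2 → A) (i j k : Fin 2) : A :=
  S.d i (τ j k) - ∑ l, S.Γ i j l * τ l k - ∑ l, S.Γ i k l * τ j l

/-- The components of the Killing operator. -/
def L (ξ : Fin 2 → A) (i j : Fin 2) : A := S.c * (S.covForm ξ i j + S.covForm ξ j i)

/-- The components of the operator `B`. -/
def B (τ : Fin 2 → Fin 2 → A) (k : Fin 2) : A :=
  S.s * (S.covTensor τ 0 1 k - S.covTensor τ 1 0 k)

/-- The operator `D` in components. -/
def D (β : Fin 2 → A) : A :=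
  S.c * S.s * (β 0 * S.phi 1 - S.phi 0 * β 1 - (S.covForm β 0 1 - S.covForm β 1 0))

/-- The components of the operator `Z`. -/
def Z (τ : Fin 2 → Fin 2 → A) (k : Fin 2) : A :=
  2 * S.d k (S.D (S.B τ)) + 4 * S.B τ k - ∑ i, S.w i * τ i k
    + 3 * S.c * S.D (S.B τ) * S.phi k

/-- The components of the covariant derivative of a vector field. -/
def covField (W : Fin 2 → A) (k j : Fin 2) : A := S.d k (W j) + ∑ i, W i * S.Γ k i j

/-- The component `Q_k^j` of the morphism `Q`. -/
def Q (k j : Fin 2) : A :=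
  (if k = j then 4 else 0) + S.covField S.w k j + 3 * S.c * S.c * S.phi k * S.w j

theorem covField_covField_sub (hcomm : ∀ f, S.d 0 (S.d 1 f) = S.d 1 (S.d 0 f)) (W : Fin 2 → A)
    (k : Fin 2) :
    S.covField (S.covField W 0) 1 k - S.covField (S.covField W 1) 0 k =
      ∑ j, W j * S.curv j k := by
  simp only [covField, curv, Fin.sum_univ_two, map_add, Derivation.leibniz, smul_eq_mul, hcomm]
  ring

/-- The frame commutes, the connection is torsion-free, and its Ricci tensor is skew-symmetric and
nonzero. -/
structure IsRSTS : Prop where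
  comm (f : A) : S.d 0 (S.d 1 f) = S.d 1 (S.d 0 f)
  symm (k : Fin 2) : S.Γ 1 0 k = S.Γ 0 1 k
  r_mul_s : S.r * S.s = 1
  two_mul_c : 2 * S.c = 1
  curv_eq (a k : Fin 2) : S.curv a k = if a = k then S.r else 0

variable {S}

namespace IsRSTS

variable (h : S.IsRSTS)
include h

theorem d_c (i : Fin 2) : S.d i S.c = 0 := by
  have h1 : S.d i (2 * S.c) = 0 := by rw [h.two_mul_c]; simp
  have h2 : S.d i (2 * S.c) = 2 * S.d i S.c := by
    rw [two_mul, two_mul, map_add]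
  linear_combination S.c * h1 - S.c * h2 - S.d i S.c * h.two_mul_c

theorem d_s (i : Fin 2) : S.d i S.s = - (S.s * S.s * S.d i S.r) := by
  have h1 : S.d i (S.r * S.s) = 0 := by rw [h.r_mul_s]; simp
  rw [Derivation.leibniz, smul_eq_mul, smul_eq_mul] at h1
  linear_combination S.s * h1 - S.d i S.s * h.r_mul_s

theorem d_phi : S.d 0 (S.phi 1) - S.d 1 (S.phi 0) = 2 * S.r := by
  have e0 := h.curv_eq 0 0
  have e1 := h.curv_eq 1 1
  simp only [curv, Fin.sum_univ_two, if_true, h.symm] at e0 e1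
  simp only [phi, map_sub, map_add, Derivation.leibniz, smul_eq_mul, h.d_s, h.symm, h.comm]
  linear_combination e0 + e1

/-- `B (L ξ) = ξ + (dh + h φ) / 2`, where `dξ = h ρ`. -/
theorem B_L (ξ : Fin 2 → A) (k : Fin 2) :
    S.B (S.L ξ) k = ξ k + S.c * (S.d k (S.s * (S.d 0 (ξ 1) - S.d 1 (ξ 0)))
      + S.s * (S.d 0 (ξ 1) - S.d 1 (ξ 0)) * S.phi k) := by
  have e0 := h.curv_eq k 0
  have e1 := h.curv_eq k 1
  have hc := h.two_mul_c
  have hs := h.r_mul_s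
  have key : S.covTensor (S.L ξ) 0 1 k - S.covTensor (S.L ξ) 1 0 k = S.r * ξ k +
      S.c * (S.d k (S.d 0 (ξ 1) - S.d 1 (ξ 0))
        - (S.d 0 (ξ 1) - S.d 1 (ξ 0)) * (S.Γ k 0 0 + S.Γ k 1 1)) := by
    simp only [curv, Fin.sum_univ_two, h.symm] at e0 e1
    simp only [covTensor, L, covForm, Fin.sum_univ_two, map_sub, map_add, Derivation.leibniz,
      smul_eq_mul, h.d_c, h.symm, h.comm]
    fin_cases k
    · simp [h.symm] at e0 e1
      simp [h.symm, h.comm]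
      linear_combination 2 * S.c * ξ 0 * e0 + 2 * S.c * ξ 1 * e1 + S.r * ξ 0 * hc
    · simp [h.symm] at e0 e1
      simp [h.symm, h.comm]
      linear_combination 2 * S.c * ξ 0 * e0 + 2 * S.c * ξ 1 * e1 + S.r * ξ 1 * hc
  rw [B, key, phi]
  simp only [Derivation.leibniz, smul_eq_mul, h.d_s]
  linear_combination ξ k * hs 

theorem D_B_L (ξ : Fin 2 → A) :
    S.D (S.B (S.L ξ)) =
      S.c * ∑ i, ξ i * S.w i - S.s * (S.d 0 (ξ 1) - S.d 1 (ξ 0)) := by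
  have hφ := h.d_phi
  have hc := h.two_mul_c
  have hs := h.r_mul_s
  have hB := funext (h.B_L ξ)
  set H := S.s * (S.d 0 (ξ 1) - S.d 1 (ξ 0)) with hH
  have hr : S.d 0 (ξ 1) - S.d 1 (ξ 0) = S.r * H := by
    rw [hH]; linear_combination - (S.d 0 (ξ 1) - S.d 1 (ξ 0)) * hs
  clear_value H
  rw [hB]
  simp only [D, covForm, Fin.sum_univ_two, map_add, Derivation.leibniz, smul_eq_mul, h.d_c, h.symm,
    h.comm, w, Matrix.cons_val_zero, Matrix.cons_val_one]
  linear_combination -S.c * S.s * hr - S.c * S.c * S.s * H * hφ 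
    - H * hs * (S.c + 2 * S.c * S.c) - H * hc * (1 + S.c)

theorem Z_L (ξ : Fin 2 → A) (k : Fin 2) : S.Z (S.L ξ) k = ∑ j, ξ j * S.Q k j := by
  have hc := h.two_mul_c
  have hs := h.r_mul_s
  have hB := h.B_L ξ k
  have hD := h.D_B_L ξ
  rw [Z, hB, hD]
  set H := S.s * (S.d 0 (ξ 1) - S.d 1 (ξ 0)) with hH
  have hr : S.d 0 (ξ 1) - S.d 1 (ξ 0) = S.r * H := by
    rw [hH]; linear_combination - (S.d 0 (ξ 1) - S.d 1 (ξ 0)) * hs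
  clear_value H
  have hw : S.r * S.w 1 = - S.phi 0 ∧ S.r * S.w 0 = S.phi 1 := by
    constructor
    · simp only [w, Matrix.cons_val_one, Matrix.cons_val_fin_one]; linear_combination -S.phi 0 * hs
    · simp [w]; linear_combination S.phi 1 * hs
  obtain ⟨hw1, hw0⟩ := hw
  simp only [L, covForm, Q, covField, Fin.sum_univ_two, map_add, map_sub, Derivation.leibniz,
    smul_eq_mul, h.d_c]
  generalize S.w = W at *
  fin_cases k
  · simp [h.symm]
    linear_combination (2 * S.d 0 H + ξ 0 * (S.d 0 (W 0) + W 0 * S.Γ 0 0 0 + W 1 * S.Γ 0 1 0) + ξ 1 * (S.d 0 (W 1) + W 0 * S.Γ 0 0 1 + W 1 * S.Γ 0 1 1)) * hc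
      + S.c * W 1 * hr + S.c * H * hw1
  · simp [h.symm]
    linear_combination (2 * S.d 1 H + ξ 0 * (S.d 1 (W 0) + W 0 * S.Γ 0 1 0 + W 1 * S.Γ 1 1 0) + ξ 1 * (S.d 1 (W 1) + W 0 * S.Γ 0 1 1 + W 1 * S.Γ 1 1 1)) * hc
      - S.c * W 0 * hr - S.c * H * hw0
  
end IsRSTS
end FrameData

theorem two_le_infty : (2 : ℕ∞ω) ≤ ∞ := by
  change ((2 : ℕ∞) : ℕ∞ω) ≤ ((⊤ : ℕ∞) : ℕ∞ω)
  exact WithTop.coe_le_coe.2 le_top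

section Frame

variable {M : Type*} [TopologicalSpace M] [ChartedSpace Plane M] [IsManifold (𝓡 2) ∞ M]

instance (x : M) : FiniteDimensional ℝ (TangentSpace (𝓡 2) x) :=
  inferInstanceAs (FiniteDimensional ℝ Plane)

instance (x : M) : T2Space (TangentSpace (𝓡 2) x) :=
  inferInstanceAs (T2Space Plane)

instance : IsManifold (𝓡 2) (minSmoothness ℝ 2) M := by
  rw [minSmoothness_of_isRCLikeNormedField]
  exact IsManifold.of_le (n := ∞) two_le_infty

/-- The standard basis of the model plane. -/
def planeBasis : Module.Basis (Fin 2) ℝ Plane := (EuclideanSpace.basisFun (Fin 2) ℝ).toBasis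

variable (p : M)

/-- The trivialization of the tangent bundle given by the preferred chart at `p`. -/
abbrev triv : Trivialization Plane (TotalSpace.proj : TangentBundle (𝓡 2) M → M) :=
  trivializationAt Plane (TangentSpace (𝓡 2)) p

/-- The domain of the preferred chart at `p`. -/
def dom : Set M := (triv p).baseSet

theorem isOpen_dom : IsOpen (dom p) := (triv p).open_baseSet

theorem mem_dom : p ∈ dom p := FiberBundle.mem_baseSet_trivializationAt' p

variable {p} in
theorem mem_dom_iff {y : M} : y ∈ dom p ↔ y ∈ (extChartAt (𝓡 2) p).source := by
  simp [dom]

variable {p} in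
theorem dom_mem_nhds {y : M} (hy : y ∈ dom p) : dom p ∈ 𝓝 y := (isOpen_dom p).mem_nhds hy

/-- The coordinate vector fields of the preferred chart at `p`. -/
def frame (i : Fin 2) : VField M := (triv p).localFrame planeBasis i

/-- The coordinates of a tangent vector in the frame `frame p`. -/
def coord (i : Fin 2) (y : M) : TangentSpace (𝓡 2) y →ₗ[ℝ] ℝ :=
  (triv p).localFrameCoeff (𝓡 2) planeBasis i y

variable {p}

theorem frame_contMDiffOn (i : Fin 2) :
    ContMDiffOn (𝓡 2) ((𝓡 2).prod 𝓘(ℝ, Plane)) ∞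
      (fun y => TotalSpace.mk' Plane y (frame p i y)) (dom p) :=
  (triv p).contMDiffOn_localFrame_baseSet ∞ planeBasis i

theorem frame_contMDiffAt (i : Fin 2) {y : M} (hy : y ∈ dom p) :
    ContMDiffAt (𝓡 2) ((𝓡 2).prod 𝓘(ℝ, Plane)) ∞
      (fun y => TotalSpace.mk' Plane y (frame p i y)) y :=
  (frame_contMDiffOn i).contMDiffAt (dom_mem_nhds hy)

theorem frame_mdifferentiableAt (i : Fin 2) {y : M} (hy : y ∈ dom p) :
    MDifferentiableAt (𝓡 2) ((𝓡 2).prod 𝓘(ℝ, Plane))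
      (fun y => TotalSpace.mk' Plane y (frame p i y)) y :=
  (frame_contMDiffAt i hy).mdifferentiableAt (by simp)

theorem sum_coord_smul_frame {y : M} (hy : y ∈ dom p) (v : TangentSpace (𝓡 2) y) :
    v = ∑ i, coord p i y v • frame p i y := by
  have := (triv p).eq_sum_localFrameCoeff_smul (I := 𝓡 2) (b := planeBasis) (s := ext v) hy
  rwa [ext, FiberBundle.extend_apply_self] at this

theorem frame_eq_symmL {y : M} (hy : y ∈ dom p) (i : Fin 2) :
    frame p i y = (triv p).symmL ℝ y (planeBasis i) := by
  rw [frame, Trivialization.localFrame_apply_of_mem_baseSet _ _ hy]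
  rw [Trivialization.symmL_apply _ hy]
  simp [Trivialization.basisAt]
  rfl

theorem coord_frame {y : M} (hy : y ∈ dom p) (i j : Fin 2) :
    coord p i y (frame p j y) = if j = i then 1 else 0 := by
  have h := (triv p).localFrameCoeff_apply_of_mem_baseSet (I := 𝓡 2) planeBasis hy (frame p j) i
  rw [coord, h, frame, Trivialization.localFrame_apply_of_mem_baseSet _ _ hy,
    Module.Basis.repr_self, Finsupp.single_apply]

theorem mem_source_of_mem_dom {y : M} (hy : y ∈ dom p) : y ∈ (chartAt Plane p).source := by
  simpa [mem_dom_iff] using hy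

theorem mvfderiv_frame {f : M → ℝ} {y : M} (hy : y ∈ dom p)
    (hf : MDifferentiableAt (𝓡 2) 𝓘(ℝ, ℝ) f y) (i : Fin 2) :
    mvfderiv (𝓡 2) f y (frame p i y) =
      fderiv ℝ (f ∘ (extChartAt (𝓡 2) p).symm) (extChartAt (𝓡 2) p y) (planeBasis i) := by
  have hs := mem_source_of_mem_dom hy
  have hs' : y ∈ (extChartAt (𝓡 2) p).source := mem_dom_iff.1 hy
  have ht := (extChartAt (𝓡 2) p).map_source hs'
  have hl := (extChartAt (𝓡 2) p).left_inv hs'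
  rw [frame_eq_symmL hy, TangentBundle.symmL_trivializationAt hs]
  have hφ : MDifferentiableAt 𝓘(ℝ, Plane) (𝓡 2) (extChartAt (𝓡 2) p).symm
      (extChartAt (𝓡 2) p y) := by
    have := mdifferentiableWithinAt_extChartAt_symm (I := 𝓡 2) ht
    rwa [ModelWithCorners.range_eq_univ, mdifferentiableWithinAt_univ] at this
  rw [ModelWithCorners.range_eq_univ, mfderivWithin_univ]
  have hc := mvfderiv_comp_apply_of_eq (extChartAt (𝓡 2) p y) hf hφ hl (planeBasis i)
  have h2 : mvfderiv 𝓘(ℝ, Plane) (f ∘ (extChartAt (𝓡 2) p).symm) (extChartAt (𝓡 2) p y)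
      = fderiv ℝ (f ∘ (extChartAt (𝓡 2) p).symm) (extChartAt (𝓡 2) p y) := by
    rw [mvfderiv, mfderiv_eq_fderiv]; rfl
  rw [h2] at hc
  exact hc.symm

theorem mlieBracket_frame {y : M} (hy : y ∈ dom p) (i j : Fin 2) :
    VectorField.mlieBracket (𝓡 2) (frame p i) (frame p j) y = 0 := by
  have hs := mem_source_of_mem_dom hy
  let X : Fin 2 → (x : Plane) → TangentSpace 𝓘(ℝ, Plane) x := fun i _ => planeBasis i
  have hX : ∀ i, MDifferentiableAt 𝓘(ℝ, Plane) (𝓘(ℝ, Plane).prod 𝓘(ℝ, Plane))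
      (fun x => TotalSpace.mk' Plane x (X i x)) (extChartAt (𝓡 2) p y) := by
    intro i
    rw [mdifferentiableAt_section]
    simpa [X] using! mdifferentiableAt_const
  have hpull : ∀ i, ∀ z ∈ dom p, frame p i z =
      VectorField.mpullback (𝓡 2) 𝓘(ℝ, Plane) (extChartAt (𝓡 2) p) (X i) z := by
    intro i z hz
    rw [VectorField.mpullback_apply, frame_eq_symmL hz,
      ← TangentBundle.continuousLinearMapAt_trivializationAt (mem_source_of_mem_dom hz),
      ← Trivialization.coe_continuousLinearEquivAt_eq' _ hz]
    have h := ContinuousLinearMap.inverse_equiv ((triv p).continuousLinearEquivAt ℝ z hz)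
    have h2 := DFunLike.congr_fun h (planeBasis i)
    refine (h2.trans ?_).symm
    rw [← Trivialization.symm_continuousLinearEquivAt_eq' _ hz]
  have hb : VectorField.mlieBracket 𝓘(ℝ, Plane) (X i) (X j) (extChartAt (𝓡 2) p y) = 0 := by
    rw [← VectorField.mlieBracketWithin_univ, VectorField.mlieBracketWithin_eq_lieBracketWithin]
    simp [VectorField.lieBracketWithin, X]
    rfl
  have h := VectorField.mpullback_mlieBracket (I := 𝓡 2) (n := ∞) (hX i) (hX j)
    (contMDiffAt_extChartAt' hs) (by rw [minSmoothness_of_isRCLikeNormedField]; exact two_le_infty)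
  rw [VectorField.mpullback_apply, hb, map_zero] at h
  rw [h]
  refine Filter.EventuallyEq.mlieBracket_vectorField_eq ?_ ?_
  · filter_upwards [dom_mem_nhds hy] with z hz using hpull i z hz
  · filter_upwards [dom_mem_nhds hy] with z hz using hpull j z hz

theorem contDiffOn_chart_comp {f : M → ℝ} (hf : ContMDiffOn (𝓡 2) 𝓘(ℝ, ℝ) ∞ f (dom p)) :
    ContDiffOn ℝ ∞ (f ∘ (extChartAt (𝓡 2) p).symm) (extChartAt (𝓡 2) p).target := by
  rw [← contMDiffOn_iff_contDiffOn]
  refine hf.comp (contMDiffOn_extChartAt_symm p) fun z hz => ?_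
  exact mem_dom_iff.2 ((extChartAt (𝓡 2) p).map_target hz)

theorem extend_val_apply {s : Set M} (f : s → ℝ) {y : M} (hy : y ∈ s) :
    Function.extend Subtype.val f 0 y = f ⟨y, hy⟩ :=
  Subtype.val_injective.extend_apply f 0 ⟨y, hy⟩

theorem mvfderiv_congr {f g : M → ℝ} {y : M} (h : f =ᶠ[𝓝 y] g) :
    mvfderiv (𝓡 2) f y = mvfderiv (𝓡 2) g y := by
  unfold mvfderiv
  rw [h.mfderiv_eq]
  rfl

variable (p) in
/-- The algebra of `C^∞` functions on the domain of the preferred chart at `p`. -/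
def smoothFun : Subalgebra ℝ (dom p → ℝ) where
  carrier := {f | ContMDiffOn (𝓡 2) 𝓘(ℝ, ℝ) ∞ (Function.extend Subtype.val f 0) (dom p)}
  mul_mem' {f g} hf hg := (ContMDiffOn.mul hf hg).congr fun y hy => by
    simp [extend_val_apply _ hy]
  add_mem' {f g} hf hg := (ContMDiffOn.add hf hg).congr fun y hy => by
    simp [extend_val_apply _ hy]
  algebraMap_mem' r := (contMDiffOn_const (c := r)).congr fun y hy =>
    extend_val_apply _ hy

variable (p) in
/-- The algebra of `C^∞` functions on the domain of the preferred chart at `p`, as a type. -/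
def SmoothFun : Type _ := smoothFun p

instance : CommRing (SmoothFun p) := inferInstanceAs (CommRing (smoothFun p))

instance : Algebra ℝ (SmoothFun p) := inferInstanceAs (Algebra ℝ (smoothFun p))

namespace SmoothFun

/-- The extension of a function on the domain of a chart by zero. -/
def toFun (f : SmoothFun p) : M → ℝ := Function.extend Subtype.val f.1 0

instance : CoeFun (SmoothFun p) fun _ => M → ℝ := ⟨toFun⟩

theorem toFun_val (f : SmoothFun p) (y : dom p) : f y = f.1 y :=
  Subtype.val_injective.extend_apply _ _ _

theorem contMDiffOn (f : SmoothFun p) : ContMDiffOn (𝓡 2) 𝓘(ℝ, ℝ) ∞ f (dom p) := f.2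

theorem contMDiffAt (f : SmoothFun p) {y : M} (hy : y ∈ dom p) :
    ContMDiffAt (𝓡 2) 𝓘(ℝ, ℝ) ∞ f y := f.contMDiffOn.contMDiffAt (dom_mem_nhds hy)

theorem mdifferentiableAt (f : SmoothFun p) {y : M} (hy : y ∈ dom p) :
    MDifferentiableAt (𝓡 2) 𝓘(ℝ, ℝ) f y := (f.contMDiffAt hy).mdifferentiableAt (by simp)

theorem ext_dom {f g : SmoothFun p} (h : ∀ y ∈ dom p, f y = g y) : f = g := by
  refine Subtype.ext (funext fun y => ?_)
  rw [← toFun_val, ← toFun_val, h _ y.2]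

/-- The restriction of a function on `M` to the domain of a chart. -/
def mk (F : M → ℝ) (hF : ContMDiffOn (𝓡 2) 𝓘(ℝ, ℝ) ∞ F (dom p)) : SmoothFun p :=
  ⟨fun y => F y, hF.congr fun y hy =>
    extend_val_apply _ hy⟩

theorem mk_apply {F : M → ℝ} (hF : ContMDiffOn (𝓡 2) 𝓘(ℝ, ℝ) ∞ F (dom p)) {y : M}
    (hy : y ∈ dom p) : mk F hF y = F y := by
  lift y to dom p using hy
  rw [toFun_val]
  rfl

variable {f g : SmoothFun p} {y : M} (hy : y ∈ dom p)

include hy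

theorem add_apply : (f + g) y = f y + g y := by
  lift y to dom p using hy
  simp only [toFun_val]
  rfl

theorem sub_apply : (f - g) y = f y - g y := by
  lift y to dom p using hy
  simp only [toFun_val]
  rfl

theorem mul_apply : (f * g) y = f y * g y := by
  lift y to dom p using hy
  simp only [toFun_val]
  rfl

theorem neg_apply : (-f) y = - f y := by
  lift y to dom p using hy
  simp only [toFun_val]
  rfl

theorem smul_apply (r : ℝ) : (r • f) y = r * f y := by
  lift y to dom p using hy
  simp only [toFun_val]
  rfl

theorem algebraMap_apply (r : ℝ) : (algebraMap ℝ (SmoothFun p) r) y = r := by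
  lift y to dom p using hy
  rw [toFun_val]
  rfl

theorem one_apply : (1 : SmoothFun p) y = 1 := by
  lift y to dom p using hy
  simp only [toFun_val]
  rfl

theorem zero_apply : (0 : SmoothFun p) y = 0 := by
  lift y to dom p using hy
  simp only [toFun_val]
  rfl

theorem ofNat_apply (n : ℕ) [n.AtLeastTwo] :
    (OfNat.ofNat n : SmoothFun p) y = (OfNat.ofNat n : ℝ) := by
  lift y to dom p using hy
  rw [toFun_val]
  rfl

theorem sum_apply (F : Fin 2 → SmoothFun p) : (∑ i, F i) y = ∑ i, F i y := by
  rw [Fin.sum_univ_two, Fin.sum_univ_two, add_apply hy]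

end SmoothFun

theorem eventuallyEq_of_eqOn {F G : M → ℝ} (hy : y ∈ dom p) (h : ∀ z ∈ dom p, F z = G z) :
    F =ᶠ[𝓝 y] G := by
  filter_upwards [dom_mem_nhds hy] using h

theorem contMDiffOn_mvfderiv_frame {f : M → ℝ} (hf : ContMDiffOn (𝓡 2) 𝓘(ℝ, ℝ) ∞ f (dom p))
    (i : Fin 2) :
    ContMDiffOn (𝓡 2) 𝓘(ℝ, ℝ) ∞ (fun y => mvfderiv (𝓡 2) f y (frame p i y)) (dom p) := by
  have hF := contDiffOn_chart_comp hf
  have h1 : ContDiffOn ℝ ∞ (fun z => fderiv ℝ (f ∘ (extChartAt (𝓡 2) p).symm) z (planeBasis i))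
      (extChartAt (𝓡 2) p).target :=
    (hF.fderiv_of_isOpen (isOpen_extChartAt_target p) (by simp)).clm_apply contDiffOn_const
  have h2 := h1.contMDiffOn.comp ((contMDiffOn_extChartAt (I := 𝓡 2) (n := ∞) (x := p)).mono
    (fun _ hy => mem_source_of_mem_dom hy))
    (fun y hy => (extChartAt (𝓡 2) p).map_source (mem_dom_iff.1 hy))
  refine h2.congr fun y hy => ?_
  exact mvfderiv_frame hy ((hf.contMDiffAt (dom_mem_nhds hy)).mdifferentiableAt (by simp)) i

theorem mvfderiv_frame_comm {f : M → ℝ} (hf : ContMDiffOn (𝓡 2) 𝓘(ℝ, ℝ) ∞ f (dom p))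
    (i j : Fin 2) {y : M} (hy : y ∈ dom p) :
    mvfderiv (𝓡 2) (fun z => mvfderiv (𝓡 2) f z (frame p j z)) y (frame p i y) =
      mvfderiv (𝓡 2) (fun z => mvfderiv (𝓡 2) f z (frame p i z)) y (frame p j y) := by
  have hF := contDiffOn_chart_comp hf
  have hy' : y ∈ (extChartAt (𝓡 2) p).source := mem_dom_iff.1 hy
  have ht := (extChartAt (𝓡 2) p).map_source hy'
  have htn := (isOpen_extChartAt_target (I := 𝓡 2) p).mem_nhds ht
  have key : ∀ i j : Fin 2,
      mvfderiv (𝓡 2) (fun z => mvfderiv (𝓡 2) f z (frame p j z)) y (frame p i y) =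
      fderiv ℝ (fderiv ℝ (f ∘ (extChartAt (𝓡 2) p).symm)) (extChartAt (𝓡 2) p y)
        (planeBasis i) (planeBasis j) := by
    intro i j
    rw [mvfderiv_frame hy (((contMDiffOn_mvfderiv_frame hf j).contMDiffAt
      (dom_mem_nhds hy)).mdifferentiableAt (by simp)) i]
    have he : (fun z => mvfderiv (𝓡 2) f z (frame p j z)) ∘ (extChartAt (𝓡 2) p).symm
        =ᶠ[𝓝 (extChartAt (𝓡 2) p y)]
        fun z => fderiv ℝ (f ∘ (extChartAt (𝓡 2) p).symm) z (planeBasis j) := by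
      filter_upwards [htn] with z hz
      have hz' : (extChartAt (𝓡 2) p).symm z ∈ dom p := by
        exact mem_dom_iff.2 ((extChartAt (𝓡 2) p).map_target hz)
      rw [Function.comp_apply, mvfderiv_frame hz'
        ((hf.contMDiffAt (dom_mem_nhds hz')).mdifferentiableAt (by simp)),
        (extChartAt (𝓡 2) p).right_inv hz]
    rw [he.fderiv_eq]
    have hd : DifferentiableAt ℝ (fderiv ℝ (f ∘ (extChartAt (𝓡 2) p).symm))
        (extChartAt (𝓡 2) p y) :=
      ((hF.fderiv_of_isOpen (m := ∞) (isOpen_extChartAt_target p) (by simp)).contDiffAt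
        htn).differentiableAt (by simp)
    rw [fderiv_clm_apply hd (differentiableAt_const _)]
    simp
  rw [key i j, key j i]
  exact ((hF.contDiffAt htn).isSymmSndFDerivAt
    (by rw [minSmoothness_of_isRCLikeNormedField]; exact two_le_infty)).eq _ _

variable (p) in
/-- The derivation of the algebra of smooth functions given by a coordinate vector field. -/
def deriv (i : Fin 2) : Derivation ℝ (SmoothFun p) (SmoothFun p) :=
  Derivation.mk'
    { toFun f := SmoothFun.mk _ (contMDiffOn_mvfderiv_frame f.contMDiffOn i)
      map_add' f g := SmoothFun.ext_dom fun y hy => by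
        rw [SmoothFun.add_apply hy, SmoothFun.mk_apply _ hy, SmoothFun.mk_apply _ hy,
          SmoothFun.mk_apply _ hy, mvfderiv_congr (eventuallyEq_of_eqOn hy (G := ⇑f + ⇑g)
            fun _ hz => SmoothFun.add_apply hz),
          mvfderiv_add (f.mdifferentiableAt hy) (g.mdifferentiableAt hy)]
        rfl
      map_smul' r f := SmoothFun.ext_dom fun y hy => by
        have hr : MDifferentiableAt (𝓡 2) 𝓘(ℝ, ℝ) (fun _ : M => r) y := mdifferentiableAt_const
        rw [RingHom.id_apply, SmoothFun.smul_apply hy, SmoothFun.mk_apply _ hy,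
          SmoothFun.mk_apply _ hy, mvfderiv_congr (eventuallyEq_of_eqOn hy (G := (fun _ => r) * ⇑f)
            fun _ hz => SmoothFun.smul_apply hz r),
          mvfderiv_mul hr (f.mdifferentiableAt hy), mvfderiv_const]
        simp }
    fun f g => SmoothFun.ext_dom fun y hy => by
      change SmoothFun.mk _ (contMDiffOn_mvfderiv_frame (f * g).contMDiffOn i) y =
        (f * SmoothFun.mk _ (contMDiffOn_mvfderiv_frame g.contMDiffOn i) +
          g * SmoothFun.mk _ (contMDiffOn_mvfderiv_frame f.contMDiffOn i)) y
      rw [SmoothFun.add_apply hy, SmoothFun.mul_apply hy, SmoothFun.mul_apply hy,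
        SmoothFun.mk_apply _ hy, SmoothFun.mk_apply _ hy, SmoothFun.mk_apply _ hy,
        mvfderiv_congr (eventuallyEq_of_eqOn hy (G := ⇑f * ⇑g)
          fun _ hz => SmoothFun.mul_apply hz),
        mvfderiv_mul (f.mdifferentiableAt hy) (g.mdifferentiableAt hy)]
      rfl

theorem deriv_apply (i : Fin 2) (f : SmoothFun p) {y : M} (hy : y ∈ dom p) :
    deriv p i f y = mvfderiv (𝓡 2) f y (frame p i y) :=
  SmoothFun.mk_apply _ hy

theorem deriv_comm (f : SmoothFun p) (i j : Fin 2) :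
    deriv p i (deriv p j f) = deriv p j (deriv p i f) := by
  refine SmoothFun.ext_dom fun y hy => ?_
  rw [deriv_apply i _ hy, deriv_apply j _ hy,
    mvfderiv_congr (eventuallyEq_of_eqOn hy fun z hz => deriv_apply j f hz),
    mvfderiv_congr (eventuallyEq_of_eqOn hy fun z hz => deriv_apply i f hz)]
  exact mvfderiv_frame_comm f.contMDiffOn i j hy

end Frame

section HomBundle

variable {M : Type*} [TopologicalSpace M] [ChartedSpace Plane M] [IsManifold (𝓡 2) ∞ M]
variable {F : Type*} [NormedAddCommGroup F] [NormedSpace ℝ F]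
  {V : M → Type*} [TopologicalSpace (TotalSpace F V)]
  [∀ x, TopologicalSpace (V x)] [∀ x, AddCommGroup (V x)] [∀ x, Module ℝ (V x)]
  [∀ x, IsTopologicalAddGroup (V x)] [∀ x, ContinuousSMul ℝ (V x)]
  [FiberBundle F V] [VectorBundle ℝ F V]

theorem contMDiffAt_hom_of_basis {g : M → Plane →L[ℝ] F} {x : M}
    (h : ∀ i, ContMDiffAt (𝓡 2) 𝓘(ℝ, F) ∞ (fun y => g y (planeBasis i)) x) :
    ContMDiffAt (𝓡 2) 𝓘(ℝ, Plane →L[ℝ] F) ∞ g x := by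
  have hg : g = fun y => ∑ i : Fin 2, ContinuousLinearMap.smulRightL ℝ Plane F
      (LinearMap.toContinuousLinearMap (planeBasis.coord i)) (g y (planeBasis i)) := by
    ext y v : 2
    conv_lhs => rw [← planeBasis.sum_repr v, map_sum]
    simp
  rw [hg]
  refine ContMDiffAt.sum fun i _ => ?_
  exact (ContinuousLinearMap.contMDiff _).contMDiffAt.comp x (h i)

/-- A section of a bundle of homomorphisms from the tangent bundle is smooth at `p` if its values
on a frame are. -/
theorem contMDiffAt_hom_of_frame {s : (x : M) → TangentSpace (𝓡 2) x →L[ℝ] V x} {p : M}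
    (h : ∀ i, ContMDiffAt (𝓡 2) ((𝓡 2).prod 𝓘(ℝ, F)) ∞
      (fun y => TotalSpace.mk' F y (s y (frame p i y))) p) :
    ContMDiffAt (𝓡 2) ((𝓡 2).prod 𝓘(ℝ, Plane →L[ℝ] F)) ∞
      (fun y => TotalSpace.mk' (Plane →L[ℝ] F)
        (E := fun x : M => TangentSpace (𝓡 2) x →L[ℝ] V x) y (s y)) p := by
  rw [contMDiffAt_hom_bundle]
  refine ⟨contMDiffAt_id, contMDiffAt_hom_of_basis fun i => ?_⟩
  have h1 := (contMDiffAt_section p).1 (h i)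
  refine h1.congr_of_eventuallyEq ?_
  filter_upwards [dom_mem_nhds (mem_dom p), (trivializationAt F V p).open_baseSet.mem_nhds
    (FiberBundle.mem_baseSet_trivializationAt' p)] with y hy hy2
  simp only [ContinuousLinearMap.inCoordinates, ContinuousLinearMap.comp_apply]
  rw [frame_eq_symmL hy, Trivialization.continuousLinearMapAt_apply,
    Trivialization.linearMapAt_apply, if_pos hy2]

end HomBundle

section Smoothness

variable {M : Type*} [TopologicalSpace M] [ChartedSpace Plane M] [IsManifold (𝓡 2) ∞ M]

theorem contMDiffAt_trivial_iff {f : M → ℝ} {x : M} :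
    ContMDiffAt (𝓡 2) ((𝓡 2).prod 𝓘(ℝ, ℝ)) ∞
      (fun y => TotalSpace.mk' ℝ (E := fun _ : M => ℝ) y (f y)) x ↔
    ContMDiffAt (𝓡 2) 𝓘(ℝ, ℝ) ∞ f x := by
  rw [contMDiffAt_section]
  rfl

theorem mdifferentiableAt_trivial_iff {f : M → ℝ} {x : M} :
    MDifferentiableAt (𝓡 2) ((𝓡 2).prod 𝓘(ℝ, ℝ))
      (fun y => TotalSpace.mk' ℝ (E := fun _ : M => ℝ) y (f y)) x ↔
    MDifferentiableAt (𝓡 2) 𝓘(ℝ, ℝ) f x := by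
  rw [mdifferentiableAt_section]
  rfl

/-- Differentiability of a vector field at a point. -/
abbrev FieldMDiffAt (W : VField M) (x : M) : Prop :=
  MDifferentiableAt (𝓡 2) ((𝓡 2).prod 𝓘(ℝ, Plane)) (fun y => TotalSpace.mk' Plane y (W y)) x

/-- Smoothness of a vector field at a point. -/
abbrev FieldContMDiffAt (W : VField M) (x : M) : Prop :=
  ContMDiffAt (𝓡 2) ((𝓡 2).prod 𝓘(ℝ, Plane)) ∞ (fun y => TotalSpace.mk' Plane y (W y)) x

/-- Differentiability of a `1`-form at a point. -/
abbrev FormMDiffAt (ξ : Form M) (x : M) : Prop :=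
  MDifferentiableAt (𝓡 2) ((𝓡 2).prod 𝓘(ℝ, Plane →L[ℝ] ℝ))
    (fun y => TotalSpace.mk' (Plane →L[ℝ] ℝ)
      (E := fun x : M => TangentSpace (𝓡 2) x →L[ℝ] ℝ) y (ξ y)) x

/-- Smoothness of a `1`-form at a point. -/
abbrev FormContMDiffAt (ξ : Form M) (x : M) : Prop :=
  ContMDiffAt (𝓡 2) ((𝓡 2).prod 𝓘(ℝ, Plane →L[ℝ] ℝ)) ∞
    (fun y => TotalSpace.mk' (Plane →L[ℝ] ℝ)
      (E := fun x : M => TangentSpace (𝓡 2) x →L[ℝ] ℝ) y (ξ y)) x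

set_option synthInstance.maxHeartbeats 200000 in
/-- Differentiability of a twice-covariant tensor field at a point. -/
abbrev TensorMDiffAt (τ : Tensor₂ M) (x : M) : Prop :=
  MDifferentiableAt (𝓡 2) ((𝓡 2).prod 𝓘(ℝ, Plane →L[ℝ] Plane →L[ℝ] ℝ))
    (fun y => TotalSpace.mk' (Plane →L[ℝ] Plane →L[ℝ] ℝ)
      (E := fun x : M => TangentSpace (𝓡 2) x →L[ℝ] TangentSpace (𝓡 2) x →L[ℝ] ℝ) y (τ y)) x

set_option synthInstance.maxHeartbeats 200000 in
/-- Smoothness of a twice-covariant tensor field at a point. -/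
abbrev TensorContMDiffAt (τ : Tensor₂ M) (x : M) : Prop :=
  ContMDiffAt (𝓡 2) ((𝓡 2).prod 𝓘(ℝ, Plane →L[ℝ] Plane →L[ℝ] ℝ)) ∞
    (fun y => TotalSpace.mk' (Plane →L[ℝ] Plane →L[ℝ] ℝ)
      (E := fun x : M => TangentSpace (𝓡 2) x →L[ℝ] TangentSpace (𝓡 2) x →L[ℝ] ℝ) y (τ y)) x

theorem formContMDiffAt_of_frame {ξ : Form M} {p : M}
    (h : ∀ i, ContMDiffAt (𝓡 2) 𝓘(ℝ, ℝ) ∞ (fun y => ξ y (frame p i y)) p) :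
    FormContMDiffAt ξ p :=
  contMDiffAt_hom_of_frame (F := ℝ) (V := fun _ : M => ℝ) fun i =>
    contMDiffAt_trivial_iff.2 (h i)

set_option synthInstance.maxHeartbeats 200000 in
theorem tensorContMDiffAt_of_frame {τ : Tensor₂ M} {p : M}
    (h : ∀ i j, ContMDiffAt (𝓡 2) 𝓘(ℝ, ℝ) ∞ (fun y => τ y (frame p i y) (frame p j y)) p) :
    TensorContMDiffAt τ p :=
  contMDiffAt_hom_of_frame (F := Plane →L[ℝ] ℝ)
    (V := fun x : M => TangentSpace (𝓡 2) x →L[ℝ] ℝ) fun i =>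
    contMDiffAt_hom_of_frame (F := ℝ) (V := fun _ : M => ℝ) fun j =>
      contMDiffAt_trivial_iff.2 (h i j)

theorem FormContMDiffAt.apply {ξ : Form M} {W : VField M} {x : M}
    (hξ : FormContMDiffAt ξ x) (hW : FieldContMDiffAt W x) :
    ContMDiffAt (𝓡 2) 𝓘(ℝ, ℝ) ∞ (fun y => ξ y (W y)) x :=
  contMDiffAt_trivial_iff.1 (ContMDiffAt.clm_bundle_apply hξ hW)

theorem FormMDiffAt.apply {ξ : Form M} {W : VField M} {x : M}
    (hξ : FormMDiffAt ξ x) (hW : FieldMDiffAt W x) :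
    MDifferentiableAt (𝓡 2) 𝓘(ℝ, ℝ) (fun y => ξ y (W y)) x :=
  mdifferentiableAt_trivial_iff.1 (MDifferentiableAt.clm_bundle_apply hξ hW)

set_option synthInstance.maxHeartbeats 200000 in
theorem TensorContMDiffAt.apply {τ : Tensor₂ M} {W W' : VField M} {x : M}
    (hτ : TensorContMDiffAt τ x) (hW : FieldContMDiffAt W x) (hW' : FieldContMDiffAt W' x) :
    ContMDiffAt (𝓡 2) 𝓘(ℝ, ℝ) ∞ (fun y => τ y (W y) (W' y)) x := by
  have h : FormContMDiffAt (fun y => τ y (W y)) x := ContMDiffAt.clm_bundle_apply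
    (E₂ := fun x : M => TangentSpace (𝓡 2) x →L[ℝ] ℝ) hτ hW
  exact h.apply hW'

set_option synthInstance.maxHeartbeats 200000 in
theorem TensorMDiffAt.apply {τ : Tensor₂ M} {W W' : VField M} {x : M}
    (hτ : TensorMDiffAt τ x) (hW : FieldMDiffAt W x) (hW' : FieldMDiffAt W' x) :
    MDifferentiableAt (𝓡 2) 𝓘(ℝ, ℝ) (fun y => τ y (W y) (W' y)) x := by
  have h : FormMDiffAt (fun y => τ y (W y)) x := MDifferentiableAt.clm_bundle_apply
    (E₂ := fun x : M => TangentSpace (𝓡 2) x →L[ℝ] ℝ) hτ hW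
  exact h.apply hW'

theorem fieldMDiffAt_ext {x : M} (v : TangentSpace (𝓡 2) x) : FieldMDiffAt (ext v) x :=
  FiberBundle.mdifferentiableAt_extend (𝓡 2) Plane v

/-- A bilinear form with its second argument fixed. -/
def evalRight {x : M} (β : TangentSpace (𝓡 2) x →L[ℝ] TangentSpace (𝓡 2) x →L[ℝ] ℝ)
    (v : TangentSpace (𝓡 2) x) : TangentSpace (𝓡 2) x →L[ℝ] ℝ :=
  LinearMap.toContinuousLinearMap
    { toFun u := β u v
      map_add' u u' := by simp
      map_smul' c u := by simp }

@[simp]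
theorem evalRight_apply {x : M}
    (β : TangentSpace (𝓡 2) x →L[ℝ] TangentSpace (𝓡 2) x →L[ℝ] ℝ)
    (u v : TangentSpace (𝓡 2) x) : evalRight β v u = β u v := rfl

variable (cov : Connection M)

/-- The covariant derivative of a differentiable `1`-form is a tensor: it can be computed with
arbitrary extensions of tangent vectors. -/
theorem exists_nablaForm {ξ : Form M} {x : M} (hξ : FormMDiffAt ξ x) :
    ∃ N : TangentSpace (𝓡 2) x →L[ℝ] TangentSpace (𝓡 2) x →L[ℝ] ℝ,
      (∀ u v, nablaForm cov ξ x u v = N v u) ∧ ∀ W : VField M, FieldMDiffAt W x → ∀ u,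
      N (W x) u = mvfderiv (𝓡 2) (fun y => ξ y (W y)) x u - ξ x (cov W x u) := by
  have hT : TensorialAt (𝓡 2) Plane (fun W : VField M =>
      mvfderiv (𝓡 2) (fun y => ξ y (W y)) x - (ξ x).comp (cov W x)) x := by
    constructor
    · intro f W hf hW
      have e : (fun y => ξ y ((f • W) y)) = f * fun y => ξ y (W y) := by
        ext y; simp
      simp only [e, mvfderiv_mul hf (hξ.apply hW), cov.isCovariantDerivativeOnUniv.leibniz hW hf]
      ext u
      simp
      ring
    · intro W W' hW hW'
      have e : (fun y => ξ y ((W + W') y)) = (fun y => ξ y (W y)) + fun y => ξ y (W' y) := by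
        ext y; simp
      simp only [e, mvfderiv_add (hξ.apply hW) (hξ.apply hW'),
        cov.isCovariantDerivativeOnUniv.add hW hW']
      ext u
      simp
      ring
  have hN : ∀ W : VField M, FieldMDiffAt W x → ∀ u, TensorialAt.mkHom _ x hT (W x) u =
      mvfderiv (𝓡 2) (fun y => ξ y (W y)) x u - ξ x (cov W x u) := by
    intro W hW u
    rw [TensorialAt.mkHom_apply hT hW]
    rfl
  refine ⟨TensorialAt.mkHom _ x hT, fun u v => ?_, hN⟩
  have := hN (ext v) (fieldMDiffAt_ext v) u
  rw [ext, FiberBundle.extend_apply_self] at this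
  rw [this, nablaForm]

set_option synthInstance.maxHeartbeats 200000 in
theorem exists_nablaTensor {τ : Tensor₂ M} {x : M} (hτ : TensorMDiffAt τ x) :
    ∃ N : TangentSpace (𝓡 2) x →L[ℝ] TangentSpace (𝓡 2) x →L[ℝ] TangentSpace (𝓡 2) x →L[ℝ] ℝ,
      (∀ u v v', nablaTensor cov τ x u v v' = N v v' u) ∧
      ∀ W W' : VField M, FieldMDiffAt W x → FieldMDiffAt W' x → ∀ u,
      N (W x) (W' x) u = mvfderiv (𝓡 2) (fun y => τ y (W y) (W' y)) x u
        - τ x (cov W x u) (W' x) - τ x (W x) (cov W' x u) := by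
  let Φ : VField M → VField M → TangentSpace (𝓡 2) x →L[ℝ] ℝ := fun W W' =>
    mvfderiv (𝓡 2) (fun y => τ y (W y) (W' y)) x - (evalRight (τ x) (W' x)).comp (cov W x)
      - (τ x (W x)).comp (cov W' x)
  have h1 : ∀ W' : VField M, FieldMDiffAt W' x → TensorialAt (𝓡 2) Plane (fun W => Φ W W') x := by
    intro W' hW'
    constructor
    · intro f W hf hW
      have e : (fun y => τ y ((f • W) y) (W' y)) = f * fun y => τ y (W y) (W' y) := by
        ext y; simp
      simp only [Φ, e, mvfderiv_mul hf (hτ.apply hW hW'),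
        cov.isCovariantDerivativeOnUniv.leibniz hW hf]
      ext u
      simp
      ring
    · intro W W₂ hW hW₂
      have e : (fun y => τ y ((W + W₂) y) (W' y)) =
          (fun y => τ y (W y) (W' y)) + fun y => τ y (W₂ y) (W' y) := by
        ext y; simp
      simp only [Φ, e, mvfderiv_add (hτ.apply hW hW') (hτ.apply hW₂ hW'),
        cov.isCovariantDerivativeOnUniv.add hW hW₂]
      ext u
      simp
      ring
  have h2 : ∀ W : VField M, FieldMDiffAt W x → TensorialAt (𝓡 2) Plane (Φ W) x := by
    intro W' hW'
    constructor
    · intro f W hf hW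
      have e : (fun y => τ y (W' y) ((f • W) y)) = f * fun y => τ y (W' y) (W y) := by
        ext y; simp
      simp only [Φ, e, mvfderiv_mul hf (hτ.apply hW' hW),
        cov.isCovariantDerivativeOnUniv.leibniz hW hf]
      ext u
      simp
      ring
    · intro W W₂ hW hW₂
      have e : (fun y => τ y (W' y) ((W + W₂) y)) =
          (fun y => τ y (W' y) (W y)) + fun y => τ y (W' y) (W₂ y) := by
        ext y; simp
      simp only [Φ, e, mvfderiv_add (hτ.apply hW' hW) (hτ.apply hW' hW₂),
        cov.isCovariantDerivativeOnUniv.add hW hW₂]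
      ext u
      simp
      ring
  have hN : ∀ W W' : VField M, FieldMDiffAt W x → FieldMDiffAt W' x → ∀ u,
      TensorialAt.mkHom₂ Φ x h1 h2 (W x) (W' x) u =
        mvfderiv (𝓡 2) (fun y => τ y (W y) (W' y)) x u
        - τ x (cov W x u) (W' x) - τ x (W x) (cov W' x u) := by
    intro W W' hW hW' u
    rw [TensorialAt.mkHom₂_apply h1 h2 hW hW']
    rfl
  refine ⟨TensorialAt.mkHom₂ Φ x h1 h2, fun u v v' => ?_, hN⟩
  have := hN (ext v) (ext v') (fieldMDiffAt_ext v) (fieldMDiffAt_ext v') u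
  simp only [ext, FiberBundle.extend_apply_self] at this
  rw [this, nablaTensor]

end Smoothness

section Connection

variable {M : Type*} [TopologicalSpace M] [T2Space M] [ChartedSpace Plane M]
  [IsManifold (𝓡 2) ∞ M] {p : M}

theorem exists_bump {s : Set M} {x : M} (hs : s ∈ 𝓝 x) :
    ∃ χ : M → ℝ, ContMDiff (𝓡 2) 𝓘(ℝ, ℝ) ∞ χ ∧ tsupport χ ⊆ s ∧ χ =ᶠ[𝓝 x] 1 := by
  obtain ⟨f, -, hf⟩ := (SmoothBumpFunction.nhds_basis_tsupport (I := 𝓡 2) x).mem_iff.1 hs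
  exact ⟨f, f.contMDiff, hf, f.eventuallyEq_one⟩

variable {cov : Connection M}

theorem cov_congr {W W' : VField M} {x : M} (hW : FieldMDiffAt W x) (h : ∀ᶠ y in 𝓝 x, W y = W' y) :
    cov W x = cov W' x := by
  refine cov.isCovariantDerivativeOnUniv.congr_of_eventuallyEq hW ?_ Filter.univ_mem h
  exact hW.congr_of_eventuallyEq (h.mono fun y hy => by simp [hy])

theorem cov_contMDiffAt (hcov : CovariantDerivative.ContMDiffCovariantDerivative cov ∞)
    {W : VField M} {s : Set M} (hs : IsOpen s) {x : M} (hx : x ∈ s)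
    (hW : ContMDiffOn (𝓡 2) ((𝓡 2).prod 𝓘(ℝ, Plane)) ∞ (fun y => TotalSpace.mk' Plane y (W y)) s) :
    ContMDiffAt (𝓡 2) ((𝓡 2).prod 𝓘(ℝ, Plane →L[ℝ] Plane)) ∞
      (fun y => TotalSpace.mk' (Plane →L[ℝ] Plane)
        (E := fun x : M => TangentSpace (𝓡 2) x →L[ℝ] TangentSpace (𝓡 2) x) y (cov W y)) x := by
  obtain ⟨χ, hχ, hχs, hχ1⟩ := exists_bump (hs.mem_nhds hx)
  have h1 : ContMDiff (𝓡 2) ((𝓡 2).prod 𝓘(ℝ, Plane)) ∞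
      (fun y => TotalSpace.mk' Plane y ((χ • W) y)) :=
    ContMDiffOn.smul_section_of_tsupport hχ.contMDiffOn hs hχs hW
  have h2 := hcov.contMDiff.contMDiff (σ := χ • W) h1.contMDiffOn
  refine (h2.contMDiffAt Filter.univ_mem).congr_of_eventuallyEq ?_
  filter_upwards [hχ1.eventuallyEq_nhds, hs.mem_nhds hx] with y hy hys
  have h3 : cov W y = cov (χ • W) y := by
    refine cov_congr ((hW.contMDiffAt (hs.mem_nhds hys)).mdifferentiableAt (by simp)) ?_
    filter_upwards [hy] with z hz
    simp [hz]
  simp only [h3]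

theorem contMDiffAt_coord {W : VField M} {y : M} (hy : y ∈ dom p) (hW : FieldContMDiffAt W y)
    (k : Fin 2) : ContMDiffAt (𝓡 2) 𝓘(ℝ, ℝ) ∞ (fun z => coord p k z (W z)) y :=
  contMDiffAt_localFrameCoeff planeBasis hy hW k

theorem contMDiffAt_cov_frame (hcov : CovariantDerivative.ContMDiffCovariantDerivative cov ∞)
    (i j : Fin 2) {y : M} (hy : y ∈ dom p) :
    FieldContMDiffAt (fun z => cov (frame p j) z (frame p i z)) y :=
  ContMDiffAt.clm_bundle_apply (E₂ := fun x : M => TangentSpace (𝓡 2) x)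
    (cov_contMDiffAt hcov (isOpen_dom p) hy (frame_contMDiffOn j)) (frame_contMDiffAt i hy)

theorem contMDiffOn_coord_cov_frame
    (hcov : CovariantDerivative.ContMDiffCovariantDerivative cov ∞) (i j k : Fin 2) :
    ContMDiffOn (𝓡 2) 𝓘(ℝ, ℝ) ∞ (fun y => coord p k y (cov (frame p j) y (frame p i y))) (dom p) :=
  fun _ hy => (contMDiffAt_coord hy (contMDiffAt_cov_frame hcov i j hy) k).contMDiffWithinAt

variable (p) in
/-- The Christoffel symbols of a smooth connection, as elements of the algebra of smooth functions
on a chart domain. -/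
def christoffel (hcov : CovariantDerivative.ContMDiffCovariantDerivative cov ∞) (i j k : Fin 2) :
    SmoothFun p :=
  SmoothFun.mk _ (contMDiffOn_coord_cov_frame hcov i j k)

theorem cov_frame (hcov : CovariantDerivative.ContMDiffCovariantDerivative cov ∞)
    (i j : Fin 2) {y : M} (hy : y ∈ dom p) :
    cov (frame p j) y (frame p i y) = ∑ k, christoffel p hcov i j k y • frame p k y := by
  refine (sum_coord_smul_frame hy _).trans (Finset.sum_congr rfl fun k _ => ?_)
  rw [christoffel, SmoothFun.mk_apply _ hy]

variable (p) in
/-- The components of a smooth connection in a coordinate frame. -/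
def baseData (hcov : CovariantDerivative.ContMDiffCovariantDerivative cov ∞) :
    FrameData (SmoothFun p) where
  d := deriv p
  Γ := christoffel p hcov
  r := 0
  s := 0
  c := algebraMap ℝ _ (1 / 2)

variable (p) in
/-- The components of a smooth connection with skew-symmetric Ricci tensor in a coordinate
frame. -/
def frameData (hcov : CovariantDerivative.ContMDiffCovariantDerivative cov ∞) :
    FrameData (SmoothFun p) :=
  { baseData p hcov with
    r := (baseData p hcov).curv 1 1
    s := Ring.inverse ((baseData p hcov).curv 1 1) }

theorem frameData_comm (hcov : CovariantDerivative.ContMDiffCovariantDerivative cov ∞)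
    (f : SmoothFun p) :
    (frameData p hcov).d 0 ((frameData p hcov).d 1 f) =
      (frameData p hcov).d 1 ((frameData p hcov).d 0 f) :=
  deriv_comm f 0 1

theorem frameData_curv (hcov : CovariantDerivative.ContMDiffCovariantDerivative cov ∞) :
    (frameData p hcov).curv 1 1 = (frameData p hcov).r := rfl

theorem frameData_symm (hcov : CovariantDerivative.ContMDiffCovariantDerivative cov ∞)
    (ht : cov.torsion = 0) (k : Fin 2) :
    (frameData p hcov).Γ 1 0 k = (frameData p hcov).Γ 0 1 k := by
  refine SmoothFun.ext_dom fun y hy => ?_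
  change christoffel p hcov 1 0 k y = christoffel p hcov 0 1 k y
  rw [christoffel, christoffel, SmoothFun.mk_apply _ hy, SmoothFun.mk_apply _ hy]
  congr 1
  have h := cov.torsion_eq_zero_iff.1 ht (frame_mdifferentiableAt (p := p) 0 hy)
    (frame_mdifferentiableAt 1 hy)
  rw [mlieBracket_frame hy, sub_eq_zero] at h
  exact h.symm

theorem fieldMDiffAt_sum_frame {F : Fin 2 → M → ℝ} {y : M} (hy : y ∈ dom p)
    (hF : ∀ k, MDifferentiableAt (𝓡 2) 𝓘(ℝ, ℝ) (F k) y) :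
    FieldMDiffAt (fun z => ∑ k, F k z • frame p k z) y := by
  simp only [Fin.sum_univ_two]
  exact mdifferentiableAt_add_section
    (MDifferentiableAt.smul_section (hF 0) (frame_mdifferentiableAt 0 hy))
    (MDifferentiableAt.smul_section (hF 1) (frame_mdifferentiableAt 1 hy))

/-- The covariant derivative of a vector field in terms of its components. -/
theorem cov_eq_sum_frame (hcov : CovariantDerivative.ContMDiffCovariantDerivative cov ∞)
    {W : VField M} {F : Fin 2 → SmoothFun p} {y : M} (hy : y ∈ dom p)
    (hW : ∀ᶠ z in 𝓝 y, W z = ∑ k, F k z • frame p k z) (j : Fin 2) :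
    cov W y (frame p j y) = ∑ m, (frameData p hcov).covField F j m y • frame p m y := by
  have hd : FieldMDiffAt (fun z => ∑ k, F k z • frame p k z) y :=
    fieldMDiffAt_sum_frame hy fun k => (F k).mdifferentiableAt hy
  rw [← cov_congr hd (hW.mono fun z hz => hz.symm)]
  have e : (fun z => ∑ k, F k z • frame p k z) = ⇑(F 0) • frame p 0 + ⇑(F 1) • frame p 1 := by
    ext z : 1
    simp [Fin.sum_univ_two]
  have hF := fun k => (F k).mdifferentiableAt hy
  have hX := fun k => frame_mdifferentiableAt (p := p) k hy
  rw [e, cov.isCovariantDerivativeOnUniv.add (MDifferentiableAt.smul_section (hF 0) (hX 0))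
    (MDifferentiableAt.smul_section (hF 1) (hX 1)),
    cov.isCovariantDerivativeOnUniv.leibniz (hX 0) (hF 0),
    cov.isCovariantDerivativeOnUniv.leibniz (hX 1) (hF 1)]
  simp only [add_apply, smul_apply,
    ContinuousLinearMap.smulRight_apply, cov_frame hcov _ _ hy, FrameData.covField, frameData,
    baseData, SmoothFun.add_apply hy, SmoothFun.mul_apply hy, Fin.sum_univ_two, deriv_apply _ _ hy]
  module

theorem exists_frame_components {W : VField M} {s : Set M} {y : M} (hs : s ∈ 𝓝 y) (hy : y ∈ dom p)
    (hW : ContMDiffOn (𝓡 2) ((𝓡 2).prod 𝓘(ℝ, Plane)) ∞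
      (fun y => TotalSpace.mk' Plane y (W y)) s) :
    ∃ F : Fin 2 → SmoothFun p, (∀ᶠ z in 𝓝 y, W z = ∑ k, F k z • frame p k z) ∧
      ∀ k, F k y = coord p k y (W y) := by
  obtain ⟨t, hts, ht, hyt⟩ := mem_nhds_iff.1 (Filter.inter_mem hs (dom_mem_nhds hy))
  obtain ⟨χ, hχ, hχs, hχ1⟩ := exists_bump (ht.mem_nhds hyt)
  have hc : ∀ k, ContMDiff (𝓡 2) 𝓘(ℝ, ℝ) ∞ (fun z => χ z * coord p k z (W z)) := by
    intro k
    refine contMDiff_of_tsupport fun z hz => ?_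
    have hzt : z ∈ t := hχs (tsupport_mul_subset_left hz)
    exact (hχ z).mul (contMDiffAt_coord (hts hzt).2
      ((hW.mono fun z hz => (hts hz).1).contMDiffAt (ht.mem_nhds hzt)) k)
  refine ⟨fun k => SmoothFun.mk _ (hc k).contMDiffOn, ?_, fun k => ?_⟩
  · filter_upwards [hχ1, ht.mem_nhds hyt] with z hz hzt
    refine (sum_coord_smul_frame (hts hzt).2 (W z)).trans (Finset.sum_congr rfl fun k _ => ?_)
    rw [SmoothFun.mk_apply _ (hts hzt).2, hz]
    simp
  · rw [SmoothFun.mk_apply _ hy, hχ1.self_of_nhds]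
    simp

end Connection

section Curvature

variable {M : Type*} [TopologicalSpace M] [T2Space M] [ChartedSpace Plane M]
  [IsManifold (𝓡 2) ∞ M] {p : M} {cov : Connection M}

/-- The curvature expression `∇_V ∇_U A - ∇_U ∇_V A + ∇_{[U,V]} A` at a point. -/
def curvatureOp (cov : Connection M) (A : VField M) (x : M) (U V : VField M) :
    TangentSpace (𝓡 2) x :=
  cov (fun y => cov A y (U y)) x (V x) - cov (fun y => cov A y (V y)) x (U x)
    + cov A x (VectorField.mlieBracket (𝓡 2) U V x)

theorem curvatureOp_swap (A : VField M) (x : M) (U V : VField M) :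
    curvatureOp cov A x U V = - curvatureOp cov A x V U := by
  unfold curvatureOp
  rw [VectorField.mlieBracket_swap_apply, map_neg]
  abel

theorem curvatureOp_tensorial {A : VField M} {x : M}
    (hA : ∀ U : VField M, FieldMDiffAt U x → FieldMDiffAt (fun y => cov A y (U y)) x)
    {V : VField M} : TensorialAt (𝓡 2) Plane (fun U => curvatureOp cov A x U V) x where
  smul {f U} hf hU := by
    have e : (fun y => cov A y ((f • U) y)) = f • fun y => cov A y (U y) := by
      ext y : 1
      simp
    simp only [curvatureOp, e, cov.isCovariantDerivativeOnUniv.leibniz (hA U hU) hf,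
      VectorField.mlieBracket_smul_left hf hU]
    simp
    module
  add {U U'} hU hU' := by
    have e : (fun y => cov A y ((U + U') y)) =
        (fun y => cov A y (U y)) + fun y => cov A y (U' y) := by
      ext y : 1
      simp
    simp only [curvatureOp, e, cov.isCovariantDerivativeOnUniv.add (hA U hU) (hA U' hU'),
      VectorField.mlieBracket_add_left hU hU']
    simp
    module

theorem curvatureOp_frame (hcov : CovariantDerivative.ContMDiffCovariantDerivative cov ∞)
    {A : VField M} {F : Fin 2 → SmoothFun p} {y : M} (hy : y ∈ dom p)
    (hA : ∀ᶠ z in 𝓝 y, A z = ∑ k, F k z • frame p k z) :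
    curvatureOp cov A y (frame p 0) (frame p 1) =
      ∑ k, (∑ j, F j y * (frameData p hcov).curv j k y) • frame p k y := by
  have h1 : ∀ i, ∀ᶠ z in 𝓝 y, cov A z (frame p i z) =
      ∑ m, (frameData p hcov).covField F i m z • frame p m z := by
    intro i
    filter_upwards [hA.eventually_nhds, dom_mem_nhds hy] with z hz hzd
    exact cov_eq_sum_frame hcov hzd hz i
  have h2 := fun k => FrameData.covField_covField_sub (frameData p hcov) (frameData_comm hcov) F k
  rw [curvatureOp, cov_eq_sum_frame hcov hy (h1 0), cov_eq_sum_frame hcov hy (h1 1),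
    mlieBracket_frame hy, map_zero, add_zero, ← Finset.sum_sub_distrib]
  refine Finset.sum_congr rfl fun k _ => ?_
  rw [← sub_smul, ← SmoothFun.sub_apply hy, h2, SmoothFun.sum_apply hy]
  simp only [SmoothFun.mul_apply hy]

theorem curvature_eq (hcov : CovariantDerivative.ContMDiffCovariantDerivative cov ∞)
    {y : M} (hy : y ∈ dom p) (u v a : TangentSpace (𝓡 2) y) :
    curvature cov y u v a =
      (coord p 0 y u * coord p 1 y v - coord p 1 y u * coord p 0 y v) •
        ∑ k, (∑ j, coord p j y a * (frameData p hcov).curv j k y) • frame p k y := by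
  obtain ⟨s, hs, hsm⟩ := FiberBundle.exists_contMDiffOn_extend (k := ∞) (𝓡 2) Plane a
  obtain ⟨F, hF, hFy⟩ := exists_frame_components hs hy hsm
  obtain ⟨t, hts, ht, hyt⟩ := mem_nhds_iff.1 hs
  have hA : ∀ U : VField M, FieldMDiffAt U y → FieldMDiffAt (fun z => cov (ext a) z (U z)) y :=
    fun U hU => MDifferentiableAt.clm_bundle_apply (E₂ := fun x : M => TangentSpace (𝓡 2) x)
      ((cov_contMDiffAt hcov ht hyt (hsm.mono hts)).mdifferentiableAt (by simp)) hU
  have h1 : ∀ V : VField M, FieldMDiffAt V y →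
      TensorialAt (𝓡 2) Plane (fun U => curvatureOp cov (ext a) y U V) y :=
    fun V _ => curvatureOp_tensorial hA
  have h2 : ∀ U : VField M, FieldMDiffAt U y →
      TensorialAt (𝓡 2) Plane (curvatureOp cov (ext a) y U) y := by
    intro U _
    constructor
    · intro f V hf hV
      rw [curvatureOp_swap, (curvatureOp_tensorial hA).smul hf hV, curvatureOp_swap _ _ U, smul_neg]
    · intro V V' hV hV'
      rw [curvatureOp_swap, (curvatureOp_tensorial hA).add hV hV', curvatureOp_swap _ _ U,
        curvatureOp_swap _ _ U, neg_add]
  set N := TensorialAt.mkHom₂ _ y h1 h2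
  have hN : ∀ U V : VField M, FieldMDiffAt U y → FieldMDiffAt V y →
      N (U y) (V y) = curvatureOp cov (ext a) y U V := fun U V hU hV =>
    TensorialAt.mkHom₂_apply h1 h2 hU hV
  have hR : curvature cov y u v a = N u v := by
    have := hN (ext u) (ext v) (fieldMDiffAt_ext u) (fieldMDiffAt_ext v)
    simp only [ext, FiberBundle.extend_apply_self] at this
    rw [this, curvature, curvatureOp]
    simp only [ext, FiberBundle.extend_apply_self]
  have h00 := hN _ _ (frame_mdifferentiableAt 0 hy) (frame_mdifferentiableAt 0 hy)
  have h11 := hN _ _ (frame_mdifferentiableAt 1 hy) (frame_mdifferentiableAt 1 hy)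
  have h01 := hN _ _ (frame_mdifferentiableAt 0 hy) (frame_mdifferentiableAt 1 hy)
  have h10 := hN _ _ (frame_mdifferentiableAt 1 hy) (frame_mdifferentiableAt 0 hy)
  rw [curvatureOp_frame hcov hy hF] at h01
  rw [curvatureOp_swap, curvatureOp_frame hcov hy hF] at h10
  have hself : ∀ U : VField M, curvatureOp cov (ext a) y U U = 0 := fun U => by
    simp [curvatureOp]
  rw [hself] at h00 h11
  simp only [hFy, FiberBundle.extend_apply_self] at h01 h10
  rw [hR]
  conv_lhs => rw [sum_coord_smul_frame hy u, sum_coord_smul_frame hy v]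
  simp only [Fin.sum_univ_two (f := fun i => coord p i y u • frame p i y),
    Fin.sum_univ_two (f := fun i => coord p i y v • frame p i y), map_add, map_smul,
    add_apply, smul_apply, h00, h11, h01, h10]
  module

theorem coord_sum_frame {y : M} (hy : y ∈ dom p) (c : Fin 2 → ℝ) (i : Fin 2) :
    coord p i y (∑ k, c k • frame p k y) = c i := by
  simp only [map_sum, map_smul, coord_frame hy, smul_eq_mul, mul_ite, mul_one, mul_zero]
  simp

/-- The Ricci tensor in terms of the components of the curvature tensor. -/
theorem ricci_apply (hcov : CovariantDerivative.ContMDiffCovariantDerivative cov ∞)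
    {y : M} (hy : y ∈ dom p) (u a : TangentSpace (𝓡 2) y) :
    ricci cov y u a =
      coord p 0 y u * ∑ j, coord p j y a * (frameData p hcov).curv j 1 y
        - coord p 1 y u * ∑ j, coord p j y a * (frameData p hcov).curv j 0 y := by
  have htr : ∀ u a : TangentSpace (𝓡 2) y, LinearMap.trace ℝ (TangentSpace (𝓡 2) y)
      (toCLM fun v => curvature cov y u v a).toLinearMap =
      coord p 0 y u * ∑ j, coord p j y a * (frameData p hcov).curv j 1 y
        - coord p 1 y u * ∑ j, coord p j y a * (frameData p hcov).curv j 0 y := by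
    intro u a
    set W := ∑ k, (∑ j, coord p j y a * (frameData p hcov).curv j k y) • frame p k y with hW
    let f : TangentSpace (𝓡 2) y →ₗ[ℝ] ℝ :=
      coord p 0 y u • coord p 1 y - coord p 1 y u • coord p 0 y
    have e : (fun v => curvature cov y u v a) =
        ⇑(LinearMap.toContinuousLinearMap (f.smulRight W)) := by
      ext v : 1
      rw [curvature_eq hcov hy]
      simp [f, hW]
    have hc : ∀ k, coord p k y W = ∑ j, coord p j y a * (frameData p hcov).curv j k y :=
      fun k => coord_sum_frame hy _ k
    rw [e, toCLM_coe]
    have : (LinearMap.toContinuousLinearMap (f.smulRight W)).toLinearMap = f.smulRight W := rfl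
    rw [this, LinearMap.trace_smulRight, ← hc, ← hc]
    simp [f]
  let β : TangentSpace (𝓡 2) y →L[ℝ] TangentSpace (𝓡 2) y →L[ℝ] ℝ :=
    LinearMap.toContinuousLinearMap
      (LinearMap.toContinuousLinearMap.toLinearMap ∘ₗ
        ((coord p 0 y).smulRight (∑ j, (frameData p hcov).curv j 1 y • coord p j y)
          - (coord p 1 y).smulRight (∑ j, (frameData p hcov).curv j 0 y • coord p j y)))
  have hβ : ∀ u a, β u a = coord p 0 y u * ∑ j, coord p j y a * (frameData p hcov).curv j 1 y
        - coord p 1 y u * ∑ j, coord p j y a * (frameData p hcov).curv j 0 y := by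
    intro u a
    simp [β]
    ring
  have e : ricci cov y = β := by
    rw [ricci, ← toCLM₂_coe β]
    congr 1
    ext u a
    rw [htr, hβ]
  rw [e, hβ]

end Curvature

section Components

variable {M : Type*} [TopologicalSpace M] [T2Space M] [ChartedSpace Plane M]
  [IsManifold (𝓡 2) ∞ M] {p : M} {cov : Connection M}

/-- The `1`-form `ξ` has the smooth components `F` in the coordinate frame at `p`. -/
def FormComp (ξ : Form M) (F : Fin 2 → SmoothFun p) : Prop :=
  ∀ y ∈ dom p, ∀ k, ξ y (frame p k y) = F k y

/-- The tensor field `τ` has the smooth components `F` in the coordinate frame at `p`. -/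
def TensorComp (τ : Tensor₂ M) (F : Fin 2 → Fin 2 → SmoothFun p) : Prop :=
  ∀ y ∈ dom p, ∀ i j, τ y (frame p i y) (frame p j y) = F i j y

theorem form_apply_eq_sum {y : M} (hy : y ∈ dom p) (ξ : TangentSpace (𝓡 2) y →L[ℝ] ℝ)
    (v : TangentSpace (𝓡 2) y) : ξ v = ∑ k, coord p k y v * ξ (frame p k y) := by
  conv_lhs => rw [sum_coord_smul_frame hy v, map_sum]
  simp

theorem tensor_apply_eq_sum {y : M} (hy : y ∈ dom p)
    (τ : TangentSpace (𝓡 2) y →L[ℝ] TangentSpace (𝓡 2) y →L[ℝ] ℝ)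
    (u v : TangentSpace (𝓡 2) y) :
    τ u v = ∑ i, ∑ j, coord p i y u * coord p j y v * τ (frame p i y) (frame p j y) := by
  rw [← evalRight_apply, form_apply_eq_sum hy]
  refine Finset.sum_congr rfl fun i _ => ?_
  rw [evalRight_apply, form_apply_eq_sum hy, Finset.mul_sum]
  exact Finset.sum_congr rfl fun j _ => by ring

theorem form_ext_frame {y : M} (hy : y ∈ dom p) {ξ η : TangentSpace (𝓡 2) y →L[ℝ] ℝ}
    (h : ∀ k, ξ (frame p k y) = η (frame p k y)) : ξ = η := by
  ext v
  rw [form_apply_eq_sum hy ξ, form_apply_eq_sum hy η]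
  simp only [h]

theorem tensor_ext_frame {y : M} (hy : y ∈ dom p)
    {τ σ : TangentSpace (𝓡 2) y →L[ℝ] TangentSpace (𝓡 2) y →L[ℝ] ℝ}
    (h : ∀ i j, τ (frame p i y) (frame p j y) = σ (frame p i y) (frame p j y)) : τ = σ := by
  ext u v
  rw [tensor_apply_eq_sum hy τ, tensor_apply_eq_sum hy σ]
  simp only [h]

theorem FormComp.contMDiffAt {ξ : Form M} {F : Fin 2 → SmoothFun p} (h : FormComp ξ F) {y : M}
    (hy : y ∈ dom p) : FormContMDiffAt ξ y := by
  refine formContMDiffAt_of_frame fun i => ?_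
  have h1 : ContMDiffAt (𝓡 2) 𝓘(ℝ, ℝ) ∞
      (fun z => ∑ k, coord p k z (frame y i z) * F k z) y :=
    ContMDiffAt.sum fun k _ => (contMDiffAt_coord hy (frame_contMDiffAt i (mem_dom y)) k).mul
      ((F k).contMDiffAt hy)
  refine h1.congr_of_eventuallyEq (eventuallyEq_of_eqOn hy fun z hz => ?_)
  rw [form_apply_eq_sum hz]
  simp only [h z hz]

theorem TensorComp.contMDiffAt {τ : Tensor₂ M} {F : Fin 2 → Fin 2 → SmoothFun p}
    (h : TensorComp τ F) {y : M} (hy : y ∈ dom p) : TensorContMDiffAt τ y := by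
  refine tensorContMDiffAt_of_frame fun i j => ?_
  have hc := fun i k => contMDiffAt_coord hy (frame_contMDiffAt i (mem_dom y)) k
  have h1 : ContMDiffAt (𝓡 2) 𝓘(ℝ, ℝ) ∞
      (fun z => ∑ k, ∑ l, coord p k z (frame y i z) * coord p l z (frame y j z) * F k l z) y :=
    ContMDiffAt.sum fun k _ => ContMDiffAt.sum fun l _ =>
      ((hc i k).mul (hc j l)).mul ((F k l).contMDiffAt hy)
  refine h1.congr_of_eventuallyEq (eventuallyEq_of_eqOn hy fun z hz => ?_)
  rw [tensor_apply_eq_sum hz]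
  simp only [h z hz]

theorem FormComp.mdifferentiableAt {ξ : Form M} {F : Fin 2 → SmoothFun p} (h : FormComp ξ F) {y : M}
    (hy : y ∈ dom p) : FormMDiffAt ξ y :=
  (h.contMDiffAt hy).mdifferentiableAt (by simp)

theorem TensorComp.mdifferentiableAt {τ : Tensor₂ M} {F : Fin 2 → Fin 2 → SmoothFun p}
    (h : TensorComp τ F) {y : M} (hy : y ∈ dom p) : TensorMDiffAt τ y :=
  (h.contMDiffAt hy).mdifferentiableAt (by simp)

theorem mem_S₁_iff {ξ : Form M} :
    ξ ∈ S₁ M ↔ ∀ p : M, ∃ F : Fin 2 → SmoothFun p, FormComp ξ F := by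
  constructor
  · intro h p
    have hs : ∀ k, ContMDiffOn (𝓡 2) 𝓘(ℝ, ℝ) ∞ (fun y => ξ y (frame p k y)) (dom p) :=
      fun k y hy => (FormContMDiffAt.apply (h y) (frame_contMDiffAt k hy)).contMDiffWithinAt
    exact ⟨fun k => SmoothFun.mk _ (hs k), fun y hy k => (SmoothFun.mk_apply (hs k) hy).symm⟩
  · intro h p
    obtain ⟨F, hF⟩ := h p
    exact hF.contMDiffAt (mem_dom p)

theorem mem_S₂_iff {τ : Tensor₂ M} :
    τ ∈ S₂ M ↔ (∀ p : M, ∃ F : Fin 2 → Fin 2 → SmoothFun p, TensorComp τ F) ∧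
      ∀ x u v, τ x u v = τ x v u := by
  constructor
  · refine fun h => ⟨fun p => ?_, h.2⟩
    have hs : ∀ i j, ContMDiffOn (𝓡 2) 𝓘(ℝ, ℝ) ∞
        (fun y => τ y (frame p i y) (frame p j y)) (dom p) :=
      fun i j y hy => (TensorContMDiffAt.apply (h.1 y) (frame_contMDiffAt i hy)
        (frame_contMDiffAt j hy)).contMDiffWithinAt
    exact ⟨fun i j => SmoothFun.mk _ (hs i j),
      fun y hy i j => (SmoothFun.mk_apply (hs i j) hy).symm⟩
  · refine fun h => ⟨fun p => ?_, h.2⟩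
    obtain ⟨F, hF⟩ := h.1 p
    exact hF.contMDiffAt (mem_dom p)

theorem FormComp.add {ξ η : Form M} {F G : Fin 2 → SmoothFun p} (h : FormComp ξ F)
    (h' : FormComp η G) : FormComp (ξ + η) (F + G) := fun y hy k => by
  rw [Pi.add_apply, add_apply, h y hy, h' y hy, Pi.add_apply, SmoothFun.add_apply hy]

theorem FormComp.smul {ξ : Form M} {F : Fin 2 → SmoothFun p} (h : FormComp ξ F) (c : ℝ) :
    FormComp (c • ξ) (c • F) := fun y hy k => by
  rw [Pi.smul_apply, smul_apply, h y hy, Pi.smul_apply, SmoothFun.smul_apply hy, smul_eq_mul]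

theorem TensorComp.add {τ σ : Tensor₂ M} {F G : Fin 2 → Fin 2 → SmoothFun p} (h : TensorComp τ F)
    (h' : TensorComp σ G) : TensorComp (τ + σ) (F + G) := fun y hy i j => by
  rw [Pi.add_apply, add_apply, add_apply, h y hy, h' y hy, Pi.add_apply, Pi.add_apply,
    SmoothFun.add_apply hy]

theorem TensorComp.smul {τ : Tensor₂ M} {F : Fin 2 → Fin 2 → SmoothFun p} (h : TensorComp τ F)
    (c : ℝ) : TensorComp (c • τ) (c • F) := fun y hy i j => by
  rw [Pi.smul_apply, smul_apply, smul_apply, h y hy, Pi.smul_apply, Pi.smul_apply,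
    SmoothFun.smul_apply hy, smul_eq_mul]

/-- The covariant derivative of a `1`-form in components. -/
theorem FormComp.nablaForm {ξ : Form M} {F : Fin 2 → SmoothFun p} (h : FormComp ξ F)
    (hcov : CovariantDerivative.ContMDiffCovariantDerivative cov ∞) {y : M} (hy : y ∈ dom p) :
    ∃ N : TangentSpace (𝓡 2) y →L[ℝ] TangentSpace (𝓡 2) y →L[ℝ] ℝ,
      (∀ u v, nablaForm cov ξ y u v = N u v) ∧
      ∀ i j, N (frame p i y) (frame p j y) = (frameData p hcov).covForm F i j y := by
  obtain ⟨N, hN, hN'⟩ := exists_nablaForm cov (h.mdifferentiableAt hy)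
  refine ⟨LinearMap.toContinuousLinearMap
    { toFun u := evalRight N u
      map_add' u u' := by ext; simp
      map_smul' c u := by ext; simp }, fun u v => hN u v, fun i j => ?_⟩
  change N (frame p j y) (frame p i y) = _
  rw [hN' _ (frame_mdifferentiableAt j hy), cov_frame hcov _ _ hy,
    mvfderiv_congr (eventuallyEq_of_eqOn hy fun z hz => h z hz j)]
  simp only [map_sum, map_smul, h y hy, FrameData.covForm, frameData, baseData,
    SmoothFun.sub_apply hy, SmoothFun.sum_apply hy, SmoothFun.mul_apply hy, deriv_apply _ _ hy,
    smul_eq_mul]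

/-- The covariant derivative of a twice-covariant tensor field in components. -/
theorem TensorComp.nablaTensor {τ : Tensor₂ M} {F : Fin 2 → Fin 2 → SmoothFun p}
    (h : TensorComp τ F)
    (hcov : CovariantDerivative.ContMDiffCovariantDerivative cov ∞) {y : M} (hy : y ∈ dom p) :
    ∃ N : TangentSpace (𝓡 2) y →L[ℝ] TangentSpace (𝓡 2) y →L[ℝ] TangentSpace (𝓡 2) y →L[ℝ] ℝ,
      (∀ u v v', nablaTensor cov τ y u v v' = N v v' u) ∧
      ∀ i j k, N (frame p j y) (frame p k y) (frame p i y) =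
        (frameData p hcov).covTensor F i j k y := by
  obtain ⟨N, hN, hN'⟩ := exists_nablaTensor cov (h.mdifferentiableAt hy)
  refine ⟨N, hN, fun i j k => ?_⟩
  rw [hN' _ _ (frame_mdifferentiableAt j hy) (frame_mdifferentiableAt k hy),
    cov_frame hcov _ _ hy, cov_frame hcov _ _ hy,
    mvfderiv_congr (eventuallyEq_of_eqOn hy fun z hz => h z hz j k)]
  simp only [map_sum, map_smul, sum_apply, smul_apply, h y hy, FrameData.covTensor, frameData,
    baseData, SmoothFun.sub_apply hy, SmoothFun.sum_apply hy, SmoothFun.mul_apply hy,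
    deriv_apply _ _ hy, smul_eq_mul]

theorem killing_apply {ξ : Form M} {F : Fin 2 → SmoothFun p} (h : FormComp ξ F)
    (hcov : CovariantDerivative.ContMDiffCovariantDerivative cov ∞) {y : M} (hy : y ∈ dom p)
    (u v : TangentSpace (𝓡 2) y) :
    killing cov ξ y u v = (nablaForm cov ξ y u v + nablaForm cov ξ y v u) / 2 := by
  obtain ⟨N, hN, -⟩ := h.nablaForm hcov hy
  let β : TangentSpace (𝓡 2) y →L[ℝ] TangentSpace (𝓡 2) y →L[ℝ] ℝ :=
    (1 / 2 : ℝ) • (N + LinearMap.toContinuousLinearMap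
    { toFun u := evalRight N u
      map_add' u u' := by ext; simp
      map_smul' c u := by ext; simp })
  have hβ : ∀ u v, β u v = (nablaForm cov ξ y u v + nablaForm cov ξ y v u) / 2 := by
    intro u v
    rw [hN, hN]
    simp [β]
    ring
  have e : killing cov ξ y = β := by
    rw [killing, ← toCLM₂_coe β]
    congr 1
    ext u v
    rw [hβ]
  rw [e, hβ]

theorem FormComp.killing {ξ : Form M} {F : Fin 2 → SmoothFun p} (h : FormComp ξ F)
    (hcov : CovariantDerivative.ContMDiffCovariantDerivative cov ∞) :
    TensorComp (killing cov ξ) ((frameData p hcov).L F) := fun y hy i j => by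
  obtain ⟨N, hN, hN'⟩ := h.nablaForm hcov hy
  rw [killing_apply h hcov hy, hN, hN, hN', hN', FrameData.L, SmoothFun.mul_apply hy,
    SmoothFun.add_apply hy]
  have : (frameData p hcov).c y = 1 / 2 := SmoothFun.algebraMap_apply hy _
  rw [this]
  ring

theorem killing_mem_S₂ (hcov : CovariantDerivative.ContMDiffCovariantDerivative cov ∞)
    {ξ : Form M} (hξ : ξ ∈ S₁ M) : killing cov ξ ∈ S₂ M := by
  rw [mem_S₁_iff] at hξ
  refine mem_S₂_iff.2 ⟨fun p => ?_, fun x u v => ?_⟩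
  · obtain ⟨F, hF⟩ := hξ p
    exact ⟨_, hF.killing hcov⟩
  · obtain ⟨F, hF⟩ := hξ x
    rw [killing_apply hF hcov (mem_dom x), killing_apply hF hcov (mem_dom x), add_comm]

end Components

section Generic

variable {M : Type*} [TopologicalSpace M] [T2Space M] [ChartedSpace Plane M]
  [IsManifold (𝓡 2) ∞ M] {p : M} {cov : Connection M}

/-- The components of a generic RSTS connection in a coordinate frame. -/
abbrev IsGenericRSTS.data (hcov : IsGenericRSTS cov) (p : M) : FrameData (SmoothFun p) :=
  frameData p hcov.smooth

theorem IsGenericRSTS.ricci_frame (hcov : IsGenericRSTS cov) {y : M} (hy : y ∈ dom p)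
    (i j : Fin 2) :
    ricci cov y (frame p i y) (frame p j y) =
      if i = 0 then (hcov.data p).curv j 1 y else - (hcov.data p).curv j 0 y := by
  rw [ricci_apply hcov.smooth hy]
  simp only [coord_frame hy]
  fin_cases i <;> simp

theorem IsGenericRSTS.curv_apply (hcov : IsGenericRSTS cov) {y : M} (hy : y ∈ dom p)
    (a k : Fin 2) :
    (hcov.data p).curv a k y = if a = k then (hcov.data p).r y else 0 := by
  have h := fun i j => hcov.ricci_skew y (frame p i y) (frame p j y)
  simp only [hcov.ricci_frame hy] at h
  have h00 := h 0 0
  have h11 := h 1 1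
  have h01 := h 0 1
  simp at h00 h11 h01
  rw [← frameData_curv hcov.smooth]
  fin_cases a <;> fin_cases k <;> simp <;> linarith

/-- The Ricci tensor in components. -/
theorem IsGenericRSTS.ricci_eq (hcov : IsGenericRSTS cov) {y : M} (hy : y ∈ dom p)
    (u v : TangentSpace (𝓡 2) y) :
    ricci cov y u v = (coord p 0 y u * coord p 1 y v - coord p 1 y u * coord p 0 y v)
      * (hcov.data p).r y := by
  rw [ricci_apply hcov.smooth hy]
  simp [hcov.curv_apply hy]
  ring

theorem IsGenericRSTS.r_ne_zero (hcov : IsGenericRSTS cov) {y : M} (hy : y ∈ dom p) :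
    (hcov.data p).r y ≠ 0 := by
  intro h
  refine hcov.ricci_ne_zero y ?_
  ext u v
  rw [hcov.ricci_eq hy, h]
  simp

theorem SmoothFun.isUnit {f : SmoothFun p} (hf : ∀ y ∈ dom p, f y ≠ 0) : IsUnit f := by
  have h : ContMDiffOn (𝓡 2) 𝓘(ℝ, ℝ) ∞ (fun y => (f y)⁻¹) (dom p) :=
    f.contMDiffOn.inv₀ hf
  refine IsUnit.of_mul_eq_one (SmoothFun.mk _ h) (SmoothFun.ext_dom fun y hy => ?_)
  rw [SmoothFun.mul_apply hy, SmoothFun.mk_apply _ hy, SmoothFun.one_apply hy,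
    mul_inv_cancel₀ (hf y hy)]

theorem IsGenericRSTS.isRSTS (hcov : IsGenericRSTS cov) (p : M) : (hcov.data p).IsRSTS where
  comm := frameData_comm hcov.smooth
  symm := frameData_symm hcov.smooth hcov.torsionFree
  r_mul_s := Ring.mul_inverse_cancel _ (SmoothFun.isUnit fun _ hy => hcov.r_ne_zero hy)
  two_mul_c := by
    change 2 * algebraMap ℝ (SmoothFun p) (1 / 2) = 1
    rw [← map_ofNat (algebraMap ℝ (SmoothFun p)) 2, ← map_mul]
    norm_num
  curv_eq a k := SmoothFun.ext_dom fun y hy => by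
    rw [hcov.curv_apply hy]
    split_ifs
    · rfl
    · rw [SmoothFun.zero_apply hy]

theorem IsGenericRSTS.r_mul_s_apply (hcov : IsGenericRSTS cov) {y : M} (hy : y ∈ dom p) :
    (hcov.data p).r y * (hcov.data p).s y = 1 := by
  rw [← SmoothFun.mul_apply hy, (hcov.isRSTS p).r_mul_s, SmoothFun.one_apply hy]

theorem IsGenericRSTS.c_apply (hcov : IsGenericRSTS cov) {y : M} (hy : y ∈ dom p) :
    (hcov.data p).c y = 1 / 2 := SmoothFun.algebraMap_apply hy _

/-- The components of the Ricci tensor. -/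
def FrameData.ric {A : Type*} [CommRing A] [Algebra ℝ A] (S : FrameData A) (i j : Fin 2) : A :=
  if i = j then 0 else if i = 0 then S.r else - S.r

theorem IsGenericRSTS.tensorComp_ricci (hcov : IsGenericRSTS cov) :
    TensorComp (ricci cov) (hcov.data p).ric := fun y hy i j => by
  rw [hcov.ricci_eq hy]
  simp only [coord_frame hy, FrameData.ric]
  fin_cases i <;> fin_cases j <;> simp [SmoothFun.zero_apply hy, SmoothFun.neg_apply hy]

/-- A linear functional with prescribed components. -/
def ofComponents {y : M} (c : Fin 2 → ℝ) : TangentSpace (𝓡 2) y →L[ℝ] ℝ :=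
  LinearMap.toContinuousLinearMap (∑ k, c k • coord p k y)

theorem tensor_eq_zero_of_skew {y : M}
    {β : TangentSpace (𝓡 2) y →L[ℝ] TangentSpace (𝓡 2) y →L[ℝ] ℝ} {e₁ e₂ : TangentSpace (𝓡 2) y}
    (hs : ∀ u v, β u v = - β v u) (he : ∀ u, ∃ a b : ℝ, u = a • e₁ + b • e₂) (h : β e₁ e₂ = 0) :
    β = 0 := by
  have h21 : β e₂ e₁ = 0 := by rw [hs, h, neg_zero]
  have h11 : β e₁ e₁ = 0 := by linarith [hs e₁ e₁]
  have h22 : β e₂ e₂ = 0 := by linarith [hs e₂ e₂]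
  ext u v
  obtain ⟨a, b, rfl⟩ := he u
  obtain ⟨c, d, rfl⟩ := he v
  simp [h, h21, h11, h22]

theorem IsGenericRSTS.skewQuotient_eq (hcov : IsGenericRSTS cov) {y : M} (hy : y ∈ dom p)
    {α : TangentSpace (𝓡 2) y → TangentSpace (𝓡 2) y → ℝ} {a : ℝ}
    (hα : ∀ u v, α u v = (coord p 0 y u * coord p 1 y v - coord p 1 y u * coord p 0 y v) * a) :
    skewQuotient α (fun u v => ricci cov y u v) = a * (hcov.data p).s y := by
  have hrs := hcov.r_mul_s_apply hy
  have hc : ∀ u v, α u v = a * (hcov.data p).s y * ricci cov y u v := by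
    intro u v
    rw [hα, hcov.ricci_eq hy]
    linear_combination (-(coord p 0 y u * coord p 1 y v - coord p 1 y u * coord p 0 y v) * a) * hrs
  let e₁ : TangentSpace (𝓡 2) y := (EuclideanSpace.single 0 1 : Plane)
  let e₂ : TangentSpace (𝓡 2) y := (EuclideanSpace.single 1 1 : Plane)
  have he (u : Plane) : u = u 0 • (EuclideanSpace.single 0 1 : Plane)
      + u 1 • (EuclideanSpace.single 1 1 : Plane) := by
    ext i
    fin_cases i <;> simp
  have hne : ricci cov y e₁ e₂ ≠ 0 := fun h =>
    hcov.ricci_ne_zero y (tensor_eq_zero_of_skew (hcov.ricci_skew y) (fun u => ⟨_, _, he u⟩) h)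
  change α e₁ e₂ / ricci cov y e₁ e₂ = _
  rw [hc]
  exact mul_div_cancel_right₀ _ hne

theorem IsGenericRSTS.recurrenceForm_apply (hcov : IsGenericRSTS cov) {y : M} (hy : y ∈ dom p)
    (u : TangentSpace (𝓡 2) y) :
    recurrenceForm cov y u = ∑ k, coord p k y u * (hcov.data p).phi k y := by
  obtain ⟨N, hN, hN'⟩ := (hcov.tensorComp_ricci (p := p)).nablaTensor hcov.smooth hy
  have hrs := hcov.r_mul_s_apply hy
  have hsk : ∀ u, skewQuotient (nablaTensor cov (ricci cov) y u) (fun v v' => ricci cov y v v') =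
      ∑ k, coord p k y u * (hcov.data p).phi k y := by
    intro u
    have hphi : ∀ i, (hcov.data p).covTensor (hcov.data p).ric i 0 1 y =
        (hcov.data p).r y * (hcov.data p).phi i y := by
      intro i
      rw [← SmoothFun.mul_apply hy]
      congr 1
      simp [FrameData.covTensor, FrameData.ric, FrameData.phi, Fin.sum_univ_two]
      linear_combination -(hcov.data p).d i (hcov.data p).r * (hcov.isRSTS p).r_mul_s
    have h00 : ∀ i, (hcov.data p).covTensor (hcov.data p).ric i 0 0 y = 0 := by
      intro i
      rw [← SmoothFun.zero_apply hy]
      congr 1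
      simp [FrameData.covTensor, FrameData.ric, Fin.sum_univ_two]
    have h11 : ∀ i, (hcov.data p).covTensor (hcov.data p).ric i 1 1 y = 0 := by
      intro i
      rw [← SmoothFun.zero_apply hy]
      congr 1
      simp [FrameData.covTensor, FrameData.ric, Fin.sum_univ_two]
    have h10 : ∀ i, (hcov.data p).covTensor (hcov.data p).ric i 1 0 y =
        - ((hcov.data p).r y * (hcov.data p).phi i y) := by
      intro i
      rw [← hphi, ← SmoothFun.neg_apply hy]
      congr 1
      simp [FrameData.covTensor, FrameData.ric, Fin.sum_univ_two]
      ring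
    rw [hcov.skewQuotient_eq hy
      (a := (hcov.data p).r y * ∑ k, coord p k y u * (hcov.data p).phi k y)]
    · linear_combination (∑ k, coord p k y u * (hcov.data p).phi k y) * hrs
    · intro v v'
      rw [hN, form_apply_eq_sum hy (N v v')]
      conv_lhs => rw [sum_coord_smul_frame hy v, sum_coord_smul_frame hy v']
      simp only [Fin.sum_univ_two (f := fun i => coord p i y v • frame p i y),
        Fin.sum_univ_two (f := fun i => coord p i y v' • frame p i y), map_add, map_smul,
        add_apply, smul_apply, hN', h00, h11, h10, hphi, smul_eq_mul, Fin.sum_univ_two]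
      ring
  have e : recurrenceForm cov y = ofComponents (p := p) fun k => (hcov.data p).phi k y := by
    rw [recurrenceForm, ← toCLM_coe (ofComponents (p := p) fun k => (hcov.data p).phi k y)]
    congr 1
    ext u
    rw [hsk]
    simp [ofComponents, mul_comm]
  rw [e]
  simp [ofComponents, mul_comm]

theorem IsGenericRSTS.recurrenceField_eq (hcov : IsGenericRSTS cov) {y : M} (hy : y ∈ dom p) :
    recurrenceField cov y = ∑ k, (hcov.data p).w k y • frame p k y := by
  have hrs := hcov.r_mul_s_apply hy
  let J : (TangentSpace (𝓡 2) y →L[ℝ] ℝ) →L[ℝ] TangentSpace (𝓡 2) y :=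
    LinearMap.toContinuousLinearMap
      { toFun ξ := ((hcov.data p).s y * ξ (frame p 1 y)) • frame p 0 y
          - ((hcov.data p).s y * ξ (frame p 0 y)) • frame p 1 y
        map_add' ξ η := by
          simp only [add_apply]
          module
        map_smul' c ξ := by
          simp only [smul_apply, smul_eq_mul, RingHom.id_apply]
          module }
  have hJ : ∀ ξ, J ξ = ((hcov.data p).s y * ξ (frame p 1 y)) • frame p 0 y
          - ((hcov.data p).s y * ξ (frame p 0 y)) • frame p 1 y := fun _ => rfl
  have hinv : (ricci cov y).inverse = J := by
    refine ContinuousLinearMap.inverse_eq ?_ ?_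
    · ext ξ u
      simp [hJ, hcov.ricci_eq hy, coord_frame hy, form_apply_eq_sum hy ξ u, Fin.sum_univ_two]
      linear_combination (coord p 0 y u * ξ (frame p 0 y) + coord p 1 y u * ξ (frame p 1 y)) * hrs
    · ext u
      simp only [ContinuousLinearMap.comp_apply, hJ, hcov.ricci_eq hy, coord_frame hy,
        ContinuousLinearMap.id_apply]
      conv_rhs => rw [sum_coord_smul_frame hy u, Fin.sum_univ_two]
      simp only [if_true, one_ne_zero, zero_ne_one, if_false, sub_eq_add_neg, ← neg_smul]
      congr 1 <;> congr 1
      · linear_combination coord p 0 y u * hrs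
      · linear_combination coord p 1 y u * hrs
  rw [recurrenceField, hinv, hJ, hcov.recurrenceForm_apply hy, hcov.recurrenceForm_apply hy]
  simp [coord_frame hy, FrameData.w, SmoothFun.mul_apply hy, SmoothFun.neg_apply hy,
    Fin.sum_univ_two, sub_eq_add_neg]

end Generic

namespace FrameData

variable {A : Type*} [CommRing A] [Algebra ℝ A] (S : FrameData A)

theorem L_add (ξ η : Fin 2 → A) : S.L (ξ + η) = S.L ξ + S.L η := by
  ext i j
  simp only [L, covForm, Pi.add_apply, map_add, Fin.sum_univ_two]
  ring

theorem L_smul (a : ℝ) (ξ : Fin 2 → A) : S.L (a • ξ) = a • S.L ξ := by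
  ext i j
  simp only [L, covForm, Pi.smul_apply, Derivation.map_smul, Fin.sum_univ_two]
  simp only [Algebra.smul_def]
  ring

theorem B_add (τ σ : Fin 2 → Fin 2 → A) : S.B (τ + σ) = S.B τ + S.B σ := by
  ext k
  simp only [B, covTensor, Pi.add_apply, map_add, Fin.sum_univ_two]
  ring

theorem B_smul (a : ℝ) (τ : Fin 2 → Fin 2 → A) : S.B (a • τ) = a • S.B τ := by
  ext k
  simp only [B, covTensor, Pi.smul_apply, Derivation.map_smul, Fin.sum_univ_two]
  simp only [Algebra.smul_def]
  ring

theorem D_add (β γ : Fin 2 → A) : S.D (β + γ) = S.D β + S.D γ := by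
  simp only [D, covForm, Pi.add_apply, map_add, Fin.sum_univ_two]
  ring

theorem D_smul (a : ℝ) (β : Fin 2 → A) : S.D (a • β) = a • S.D β := by
  simp only [D, covForm, Pi.smul_apply, Derivation.map_smul, Fin.sum_univ_two]
  simp only [Algebra.smul_def]
  ring

theorem Z_add (τ σ : Fin 2 → Fin 2 → A) : S.Z (τ + σ) = S.Z τ + S.Z σ := by
  ext k
  simp only [Z, B_add, D_add, Pi.add_apply, map_add, Fin.sum_univ_two]
  ring

theorem Z_smul (a : ℝ) (τ : Fin 2 → Fin 2 → A) : S.Z (a • τ) = a • S.Z τ := by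
  ext k
  simp only [Z, B_smul, D_smul, Pi.smul_apply, Derivation.map_smul, Fin.sum_univ_two]
  simp only [Algebra.smul_def]
  ring

end FrameData

section Operators

variable {M : Type*} [TopologicalSpace M] [T2Space M] [ChartedSpace Plane M]
  [IsManifold (𝓡 2) ∞ M] {p : M} {cov : Connection M}

theorem ofComponents_apply {y : M} (c : Fin 2 → ℝ) (v : TangentSpace (𝓡 2) y) :
    ofComponents (p := p) c v = ∑ k, coord p k y v * c k := by
  simp [ofComponents, mul_comm]

set_option synthInstance.maxHeartbeats 200000 in
/-- The operator `B` in components. -/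
theorem TensorComp.opB {τ : Tensor₂ M} {F : Fin 2 → Fin 2 → SmoothFun p} (h : TensorComp τ F)
    (hcov : IsGenericRSTS cov) : FormComp (opB cov τ) ((hcov.data p).B F) := fun y hy k => by
  obtain ⟨N, hN, hN'⟩ := h.nablaTensor hcov.smooth hy
  have hB : ∀ k, (hcov.data p).B F k y = ((hcov.data p).covTensor F 0 1 k y
      - (hcov.data p).covTensor F 1 0 k y) * (hcov.data p).s y := fun k => by
    rw [FrameData.B, SmoothFun.mul_apply hy, SmoothFun.sub_apply hy, mul_comm]
  have e : RSTS.opB cov τ y = ofComponents (p := p) fun k => (hcov.data p).B F k y := by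
    rw [RSTS.opB, ← toCLM_coe (ofComponents (p := p) fun k => (hcov.data p).B F k y)]
    congr 1
    ext v
    rw [ofComponents_apply, hcov.skewQuotient_eq hy (a := ∑ k, coord p k y v *
      ((hcov.data p).covTensor F 0 1 k y - (hcov.data p).covTensor F 1 0 k y))]
    · simp only [hB, Finset.sum_mul, mul_assoc]
    · intro u u'
      rw [codazzi, hN, hN]
      conv_lhs => rw [sum_coord_smul_frame hy u, sum_coord_smul_frame hy u',
        sum_coord_smul_frame hy v]
      simp only [Fin.sum_univ_two, map_add, map_smul, add_apply, smul_apply, hN', smul_eq_mul]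
      ring
  rw [e, ofComponents_apply]
  simp [coord_frame hy]

theorem extDer_eq (ht : cov.torsion = 0) (ξ : Form M) (y : M) (u v : TangentSpace (𝓡 2) y) :
    extDer ξ y u v = nablaForm cov ξ y u v - nablaForm cov ξ y v u := by
  have h := cov.torsion_eq_zero_iff.1 ht (fieldMDiffAt_ext u) (fieldMDiffAt_ext v)
  simp only [FiberBundle.extend_apply_self] at h
  rw [extDer, nablaForm, nablaForm, ← h, map_sub]
  ring

/-- The operator `D` in components. -/
theorem FormComp.opD {β : Form M} {F : Fin 2 → SmoothFun p} (h : FormComp β F)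
    (hcov : IsGenericRSTS cov) {y : M} (hy : y ∈ dom p) :
    opD cov β y = (hcov.data p).D F y := by
  obtain ⟨N, hN, hN'⟩ := h.nablaForm hcov.smooth hy
  rw [RSTS.opD, hcov.skewQuotient_eq hy (a := F 0 y * (hcov.data p).phi 1 y
    - (hcov.data p).phi 0 y * F 1 y
    - ((hcov.data p).covForm F 0 1 y - (hcov.data p).covForm F 1 0 y))]
  · simp only [FrameData.D, SmoothFun.mul_apply hy, SmoothFun.sub_apply hy, hcov.c_apply hy]
    ring
  · intro u v
    rw [extDer_eq hcov.torsionFree, wedge, hN, hN, tensor_apply_eq_sum hy N,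
      tensor_apply_eq_sum hy N, hcov.recurrenceForm_apply hy, hcov.recurrenceForm_apply hy,
      form_apply_eq_sum hy (β y), form_apply_eq_sum hy (β y)]
    simp only [hN', h y hy, Fin.sum_univ_two]
    ring

/-- The operator `Z` in components. -/
theorem TensorComp.opZ {τ : Tensor₂ M} {F : Fin 2 → Fin 2 → SmoothFun p} (h : TensorComp τ F)
    (hcov : IsGenericRSTS cov) : FormComp (opZ cov τ) ((hcov.data p).Z F) := fun y hy k => by
  have hB := h.opB hcov
  have hD : mvfderiv (𝓡 2) (RSTS.opD cov (RSTS.opB cov τ)) y (frame p k y) =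
      (hcov.data p).d k ((hcov.data p).D ((hcov.data p).B F)) y := by
    rw [mvfderiv_congr (eventuallyEq_of_eqOn hy fun z hz => hB.opD hcov hz)]
    exact (deriv_apply _ _ hy).symm
  simp only [RSTS.opZ, add_apply, sub_apply, smul_apply, hD, hB y hy, hB.opD hcov hy,
    hcov.recurrenceForm_apply hy, hcov.recurrenceField_eq hy, map_sum, map_smul, sum_apply,
    coord_frame hy, h y hy, FrameData.Z, SmoothFun.add_apply hy, SmoothFun.sub_apply hy,
    SmoothFun.mul_apply hy, SmoothFun.sum_apply hy, SmoothFun.ofNat_apply hy, hcov.c_apply hy,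
    smul_eq_mul, ite_mul, one_mul, zero_mul, Finset.sum_ite_eq, Finset.mem_univ, if_true]
  ring

/-- The morphism `Q` in components. -/
theorem IsGenericRSTS.morphismQ_frame (hcov : IsGenericRSTS cov) {y : M} (hy : y ∈ dom p)
    (k : Fin 2) :
    morphismQ cov y (frame p k y) = ∑ j, (hcov.data p).Q k j y • frame p j y := by
  have hw : ∀ᶠ z in 𝓝 y, recurrenceField cov z = ∑ k, (hcov.data p).w k z • frame p k z := by
    filter_upwards [dom_mem_nhds hy] with z hz using hcov.recurrenceField_eq hz
  have h4 : ∀ j, (if k = j then 4 else 0 : SmoothFun p) y = if k = j then 4 else 0 := fun j => by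
    split_ifs
    · exact SmoothFun.ofNat_apply hy 4
    · exact SmoothFun.zero_apply hy
  simp only [morphismQ, add_apply, smul_apply, ContinuousLinearMap.smulRight_apply,
    ContinuousLinearMap.id_apply, cov_eq_sum_frame hcov.smooth hy hw,
    hcov.recurrenceForm_apply hy, hcov.recurrenceField_eq hy, coord_frame hy, FrameData.Q,
    SmoothFun.add_apply hy, SmoothFun.mul_apply hy, SmoothFun.ofNat_apply hy, hcov.c_apply hy, h4,
    ite_mul, one_mul, zero_mul, Finset.sum_ite_eq, Finset.mem_univ, if_true]
  fin_cases k <;> simp [Fin.sum_univ_two] <;> module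

theorem IsGenericRSTS.isInvertible_dualQ (hcov : IsGenericRSTS cov) (y : M) :
    (dualQ cov y).IsInvertible := by
  have h := hcov.isomorphism y
  let R : (TangentSpace (𝓡 2) y →L[ℝ] ℝ) →L[ℝ] (TangentSpace (𝓡 2) y →L[ℝ] ℝ) :=
    ContinuousLinearMap.precomp ℝ (morphismQ cov y).inverse
  refine ContinuousLinearMap.IsInvertible.of_inverse (g := R) ?_ ?_
  · ext ξ v
    exact congrArg ξ (h.inverse_apply_self v)
  · ext ξ v
    exact congrArg ξ (h.self_apply_inverse v)

theorem IsGenericRSTS.det_Q_ne_zero (hcov : IsGenericRSTS cov) {y : M} (hy : y ∈ dom p) :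
    ((hcov.data p).Q 0 0 * (hcov.data p).Q 1 1 - (hcov.data p).Q 0 1 * (hcov.data p).Q 1 0) y
      ≠ 0 := by
  rw [SmoothFun.sub_apply hy, SmoothFun.mul_apply hy, SmoothFun.mul_apply hy]
  intro hdet
  set q := fun i j => (hcov.data p).Q i j y with hq
  have hQ : ∀ k, morphismQ cov y (frame p k y) = ∑ j, q k j • frame p j y :=
    hcov.morphismQ_frame hy
  have hinj : ∀ v, morphismQ cov y v = 0 → v = 0 := fun v hv => by
    rw [← (hcov.isomorphism y).inverse_apply_self v, hv, map_zero]
  have hcomp : ∀ a b : ℝ, a * q 0 0 + b * q 1 0 = 0 → a * q 0 1 + b * q 1 1 = 0 →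
      a = 0 ∧ b = 0 := by
    intro a b h0 h1
    have h : a • frame p 0 y + b • frame p 1 y = 0 := by
      refine hinj _ ?_
      simp only [map_add, map_smul, hQ, Fin.sum_univ_two]
      calc a • (q 0 0 • frame p 0 y + q 0 1 • frame p 1 y)
            + b • (q 1 0 • frame p 0 y + q 1 1 • frame p 1 y)
          = (a * q 0 0 + b * q 1 0) • frame p 0 y + (a * q 0 1 + b * q 1 1) • frame p 1 y := by
            module
        _ = 0 := by rw [h0, h1, zero_smul, zero_smul, add_zero]
    have c0 := congrArg (coord p 0 y) h
    have c1 := congrArg (coord p 1 y) h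
    simp only [map_add, map_smul, coord_frame hy, map_zero] at c0 c1
    simpa using And.intro c0 c1
  have h0 := hcomp (q 1 1) (-q 0 1) (by linear_combination hdet) (by ring)
  have h1 := hcomp (q 1 0) (-q 0 0) (by ring) (by linear_combination -hdet)
  have h2 := hcomp 1 0 (by linarith [h1.2]) (by linarith [h0.2])
  exact one_ne_zero h2.1

/-- The components of the image of a `1`-form under the inverse of `Q^*`. -/
def FrameData.solveQ {A : Type*} [CommRing A] [Algebra ℝ A] (S : FrameData A) (G : Fin 2 → A) :
    Fin 2 → A :=
  ![Ring.inverse (S.Q 0 0 * S.Q 1 1 - S.Q 0 1 * S.Q 1 0) * (S.Q 1 1 * G 0 - S.Q 0 1 * G 1),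
    Ring.inverse (S.Q 0 0 * S.Q 1 1 - S.Q 0 1 * S.Q 1 0) * (S.Q 0 0 * G 1 - S.Q 1 0 * G 0)]

theorem FrameData.sum_solveQ {A : Type*} [CommRing A] [Algebra ℝ A] (S : FrameData A)
    (h : IsUnit (S.Q 0 0 * S.Q 1 1 - S.Q 0 1 * S.Q 1 0)) (G : Fin 2 → A) (k : Fin 2) :
    ∑ j, S.solveQ G j * S.Q k j = G k := by
  have := Ring.inverse_mul_cancel _ h
  fin_cases k <;> simp [solveQ, Fin.sum_univ_two]
  · linear_combination G 0 * this
  · linear_combination G 1 * this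

theorem IsGenericRSTS.dualQ_frame (hcov : IsGenericRSTS cov) {ξ : Form M}
    {F : Fin 2 → SmoothFun p} (h : FormComp ξ F) {y : M} (hy : y ∈ dom p) (k : Fin 2) :
    dualQ cov y (ξ y) (frame p k y) = (∑ j, F j * (hcov.data p).Q k j) y := by
  change ξ y (morphismQ cov y (frame p k y)) = _
  rw [hcov.morphismQ_frame hy, map_sum, SmoothFun.sum_apply hy]
  refine Finset.sum_congr rfl fun j _ => ?_
  rw [map_smul, h y hy, SmoothFun.mul_apply hy, smul_eq_mul, mul_comm]

theorem FormComp.dualQ_inverse {ζ : Form M} {G : Fin 2 → SmoothFun p} (h : FormComp ζ G)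
    (hcov : IsGenericRSTS cov) :
    FormComp (fun y => (dualQ cov y).inverse (ζ y)) ((hcov.data p).solveQ G) := fun y hy k => by
  let η : Form M := fun z => ofComponents (p := p) fun j => (hcov.data p).solveQ G j z
  have hη : FormComp η ((hcov.data p).solveQ G) := fun z hz j => by
    rw [ofComponents_apply]
    simp [coord_frame hz]
  have e : ζ y = dualQ cov y (η y) := form_ext_frame hy fun j => by
    rw [hcov.dualQ_frame hη hy, FrameData.sum_solveQ _
      (SmoothFun.isUnit fun z hz => hcov.det_Q_ne_zero hz), h y hy]
  change (dualQ cov y).inverse (ζ y) (frame p k y) = _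
  rw [e, (hcov.isInvertible_dualQ y).inverse_apply_self, hη y hy]

end Operators

section LeftInverse

variable {V W : Type*} [AddCommGroup V] [Module ℝ V] [AddCommGroup W] [Module ℝ W]
  {L : V →ₗ[ℝ] W} {K : W →ₗ[ℝ] V}

/-- A left inverse `K` of `L` makes `id - L ∘ K` the projection along the range of `L`. -/
theorem isProjection_of_leftInverse (h : ∀ v, K (L v) = v) {P : W →ₗ[ℝ] W}
    (hPLK : P = LinearMap.id - L ∘ₗ K) :
    LinearMap.range L = LinearMap.ker P ∧
    (∃ h : IsCompl (LinearMap.ker (P - LinearMap.id)) (LinearMap.range L),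
      P = Submodule.projection (LinearMap.ker (P - LinearMap.id)) (LinearMap.range L) h) ∧
    LinearMap.range P = LinearMap.ker (P - LinearMap.id) ∧
    ∀ w, w ∈ LinearMap.range P ↔ K w = 0 := by
  have hP : ∀ w, P w = w - L (K w) := fun w => by rw [hPLK]; rfl
  have hfix : ∀ w, w ∈ LinearMap.ker (P - LinearMap.id) ↔ K w = 0 := by
    intro w
    rw [LinearMap.mem_ker, LinearMap.sub_apply, LinearMap.id_apply, hP, sub_sub_cancel_left,
      neg_eq_zero]
    refine ⟨fun h0 => ?_, fun h0 => by rw [h0, map_zero]⟩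
    rw [← h (K w), h0, map_zero]
  have hKP : ∀ w, K (P w) = 0 := fun w => by rw [hP, map_sub, h, sub_self]
  have hrange : LinearMap.range P = LinearMap.ker (P - LinearMap.id) := by
    ext w
    rw [hfix]
    refine ⟨?_, fun h0 => ⟨w, by rw [hP, h0, map_zero, sub_zero]⟩⟩
    rintro ⟨w, rfl⟩
    exact hKP w
  have hcompl : IsCompl (LinearMap.ker (P - LinearMap.id)) (LinearMap.range L) := by
    refine ⟨Submodule.disjoint_def.2 ?_, codisjoint_iff.2 (Submodule.eq_top_iff'.2 fun w => ?_)⟩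
    · rintro _ hw ⟨v, rfl⟩
      rw [hfix, h] at hw
      rw [hw, map_zero]
    · exact Submodule.mem_sup.2 ⟨P w, (hfix _).2 (hKP w), L (K w), ⟨_, rfl⟩, by
        rw [hP, sub_add_cancel]⟩
  refine ⟨?_, ⟨hcompl, ?_⟩, hrange, fun w => by rw [hrange, hfix]⟩
  · ext w
    rw [LinearMap.mem_ker, hP, sub_eq_zero]
    refine ⟨?_, fun h0 => ⟨_, h0.symm⟩⟩
    rintro ⟨v, rfl⟩
    rw [h]
  · ext w
    conv_rhs => rw [← sub_add_cancel w (L (K w)), ← hP, map_add,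
      Submodule.projection_apply_of_mem_left hcompl ((hfix _).2 (hKP w)),
      Submodule.projection_apply_of_mem_right hcompl ⟨_, rfl⟩, add_zero]

end LeftInverse

section Global

variable {M : Type*} [TopologicalSpace M] [T2Space M] [ChartedSpace Plane M]
  [IsManifold (𝓡 2) ∞ M] {cov : Connection M}

theorem FormComp.eq_of_eq {p : M} {ξ η : Form M} {F G : Fin 2 → SmoothFun p} (h : FormComp ξ F)
    (h' : FormComp η G) (hFG : F = G) {y : M} (hy : y ∈ dom p) : ξ y = η y :=
  form_ext_frame hy fun k => by rw [h y hy, h' y hy, hFG]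

theorem TensorComp.eq_of_eq {p : M} {τ σ : Tensor₂ M} {F G : Fin 2 → Fin 2 → SmoothFun p}
    (h : TensorComp τ F) (h' : TensorComp σ G) (hFG : F = G) {y : M} (hy : y ∈ dom p) :
    τ y = σ y :=
  tensor_ext_frame hy fun i j => by rw [h y hy, h' y hy, hFG]

/-- The Killing operator as a linear map. -/
def IsGenericRSTS.killingMap (hcov : IsGenericRSTS cov) : S₁ M →ₗ[ℝ] S₂ M where
  toFun ξ := ⟨killing cov ξ.1, killing_mem_S₂ hcov.smooth ξ.2⟩
  map_add' ξ η := Subtype.ext <| funext fun x => by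
    obtain ⟨F, hF⟩ := mem_S₁_iff.1 ξ.2 x
    obtain ⟨G, hG⟩ := mem_S₁_iff.1 η.2 x
    exact ((hF.add hG).killing hcov.smooth).eq_of_eq
      ((hF.killing hcov.smooth).add (hG.killing hcov.smooth)) (FrameData.L_add _ _ _) (mem_dom x)
  map_smul' c ξ := Subtype.ext <| funext fun x => by
    obtain ⟨F, hF⟩ := mem_S₁_iff.1 ξ.2 x
    exact ((hF.smul c).killing hcov.smooth).eq_of_eq
      ((hF.killing hcov.smooth).smul c) (FrameData.L_smul _ _ _) (mem_dom x)

theorem IsGenericRSTS.opZ_mem_S₁ (hcov : IsGenericRSTS cov) {τ : Tensor₂ M} (hτ : τ ∈ S₂ M) :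
    opZ cov τ ∈ S₁ M := mem_S₁_iff.2 fun p =>
  let ⟨_, hF⟩ := (mem_S₂_iff.1 hτ).1 p
  ⟨_, hF.opZ hcov⟩

theorem IsGenericRSTS.opZ_add (hcov : IsGenericRSTS cov) {τ σ : Tensor₂ M} (hτ : τ ∈ S₂ M)
    (hσ : σ ∈ S₂ M) : opZ cov (τ + σ) = opZ cov τ + opZ cov σ := funext fun x => by
  obtain ⟨F, hF⟩ := (mem_S₂_iff.1 hτ).1 x
  obtain ⟨G, hG⟩ := (mem_S₂_iff.1 hσ).1 x
  exact ((hF.add hG).opZ hcov).eq_of_eq ((hF.opZ hcov).add (hG.opZ hcov))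
    (FrameData.Z_add _ _ _) (mem_dom x)

theorem IsGenericRSTS.opZ_smul (hcov : IsGenericRSTS cov) (c : ℝ) {τ : Tensor₂ M}
    (hτ : τ ∈ S₂ M) : opZ cov (c • τ) = c • opZ cov τ := funext fun x => by
  obtain ⟨F, hF⟩ := (mem_S₂_iff.1 hτ).1 x
  exact ((hF.smul c).opZ hcov).eq_of_eq ((hF.opZ hcov).smul c)
    (FrameData.Z_smul _ _ _) (mem_dom x)

/-- The operator `Z` as a linear map. -/
def IsGenericRSTS.opZMap (hcov : IsGenericRSTS cov) : S₂ M →ₗ[ℝ] S₁ M where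
  toFun τ := ⟨opZ cov τ.1, hcov.opZ_mem_S₁ τ.2⟩
  map_add' τ σ := Subtype.ext (hcov.opZ_add τ.2 σ.2)
  map_smul' c τ := Subtype.ext (hcov.opZ_smul c τ.2)

/-- The inverse of `Q^*` as a linear map on smooth `1`-forms. -/
def IsGenericRSTS.dualQInverseMap (hcov : IsGenericRSTS cov) : S₁ M →ₗ[ℝ] S₁ M where
  toFun ζ := ⟨fun y => (dualQ cov y).inverse (ζ.1 y), mem_S₁_iff.2 fun p =>
    let ⟨_, hF⟩ := mem_S₁_iff.1 ζ.2 p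
    ⟨_, hF.dualQ_inverse hcov⟩⟩
  map_add' ζ η := Subtype.ext <| funext fun y =>
    (dualQ cov y).inverse.map_add (ζ.1 y) (η.1 y)
  map_smul' c ζ := Subtype.ext <| funext fun y =>
    (dualQ cov y).inverse.map_smul c (ζ.1 y)

theorem IsGenericRSTS.opZ_killing (hcov : IsGenericRSTS cov) {ξ : Form M} (hξ : ξ ∈ S₁ M) (x : M) :
    opZ cov (killing cov ξ) x = dualQ cov x (ξ x) := by
  obtain ⟨F, hF⟩ := mem_S₁_iff.1 hξ x
  refine form_ext_frame (mem_dom x) fun k => ?_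
  rw [(hF.killing hcov.smooth).opZ hcov x (mem_dom x), hcov.dualQ_frame hF (mem_dom x),
    (hcov.isRSTS x).Z_L]

theorem IsGenericRSTS.dualQInverseMap_opZMap_killingMap (hcov : IsGenericRSTS cov) (ξ : S₁ M) :
    (hcov.dualQInverseMap ∘ₗ hcov.opZMap) (hcov.killingMap ξ) = ξ :=
  Subtype.ext <| funext fun x => by
    change (dualQ cov x).inverse (opZ cov (killing cov ξ.1) x) = ξ.1 x
    rw [hcov.opZ_killing ξ.2, (hcov.isInvertible_dualQ x).inverse_apply_self]

theorem IsGenericRSTS.dualQInverseMap_opZMap_eq_zero_iff (hcov : IsGenericRSTS cov) (τ : S₂ M) :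
    (hcov.dualQInverseMap ∘ₗ hcov.opZMap) τ = 0 ↔ ∀ x, opZ cov τ.1 x = 0 := by
  constructor
  · intro h x
    have hx : (dualQ cov x).inverse (opZ cov τ.1 x) = 0 := congrFun (congrArg Subtype.val h) x
    rw [← (hcov.isInvertible_dualQ x).self_apply_inverse (opZ cov τ.1 x), hx,
      ContinuousLinearMap.map_zero]
  · refine fun h => Subtype.ext <| funext fun x => ?_
    change (dualQ cov x).inverse (opZ cov τ.1 x) = 0
    rw [h, ContinuousLinearMap.map_zero]

set_option synthInstance.maxHeartbeats 200000 in
/-- The operator `P` as a linear map. -/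
def IsGenericRSTS.opPMap (hcov : IsGenericRSTS cov) : S₂ M →ₗ[ℝ] S₂ M :=
  LinearMap.id - hcov.killingMap ∘ₗ hcov.dualQInverseMap ∘ₗ hcov.opZMap

end Global
end RSTS
end

set_option synthInstance.maxHeartbeats 200000 in
theorem theorem14p1 {M : Type*} [TopologicalSpace M] [T2Space M]
    [ChartedSpace (EuclideanSpace ℝ (Fin 2)) M] [IsManifold (𝓡 2) ∞ M]
    (cov : RSTS.Connection M) (hcov : RSTS.IsGenericRSTS cov) :
    ∃ (L : RSTS.S₁ M →ₗ[ℝ] RSTS.S₂ M) (P : RSTS.S₂ M →ₗ[ℝ] RSTS.S₂ M),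
      (∀ (ξ : RSTS.S₁ M) (x : M), (L ξ).1 x = RSTS.killing cov ξ.1 x) ∧
      (∀ (τ : RSTS.S₂ M) (x : M), (P τ).1 x = RSTS.opP cov τ.1 x) ∧
      LinearMap.range L = LinearMap.ker P ∧
      (∃ h : IsCompl (LinearMap.ker (P - LinearMap.id)) (LinearMap.range L),
        P = Submodule.projection (LinearMap.ker (P - LinearMap.id)) (LinearMap.range L) h) ∧
      LinearMap.range P = LinearMap.ker (P - LinearMap.id) ∧
      (∀ τ : RSTS.S₂ M, τ ∈ LinearMap.range P ↔ ∀ x : M, RSTS.opZ cov τ.1 x = 0) := by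
  obtain ⟨h₁, h₂, h₃, h₄⟩ := RSTS.isProjection_of_leftInverse (V := RSTS.S₁ M) (W := RSTS.S₂ M)
    hcov.dualQInverseMap_opZMap_killingMap rfl
  exact ⟨hcov.killingMap, hcov.opPMap, fun _ _ => rfl, fun _ _ => rfl, h₁, h₂, h₃, fun τ =>
    (h₄ τ).trans (hcov.dualQInverseMap_opZMap_eq_zero_iff τ)⟩
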